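/- Identify $\mathbb R^2$ with $\mathbb C$, $z=re^{i\theta}$. Let $\mathcal S:\mathbb C\to\mathbb S^2\subset\mathbb R^3$, $\mathcal S(w)=\frac{1}{1+|w|^2}(2\,\mathrm{Re}\,w,\,2\,\mathrm{Im}\,w,\,|w|^2-1)$, be the inverse stereographic projection, let $m\ge 1$ be an integer, and let $U_m(z)=\mathcal S(z^m)$ be the standard $m$-corotational harmonic map from $\mathbb R^2$ to $\mathbb S^2$. For $u:\mathbb R^2\to\mathbb S^2$ smooth, the linearized harmonic map operator at $u$ is $$L_u[v]=\Delta v+|\nabla u|^2v+2(\nabla u\cdot\nabla v)\,u ,$$ and $\ker L_u$ denotes the real vector space of all $C^2$ maps $v:\mathbb C\to\mathbb R^3$ with $v(z)\cdot u(z)=0$ for all $z$ (that is, $v(z)\in T_{u(z)}\mathbb S^2$), $\sup_{z}(|v|+|\partial v|+|\partial^2 v|)<\infty$ and $L_u[v]=0$. Put $Q_m(r)=\pi-2\arctan(r^m)$, $$E_1=(-\sin m\theta,\cos m\theta,0),\qquad E_2=(\cos m\theta\cos Q_m,\ \sin m\theta\cos Q_m,\ -\sin Q_m),$$ and define, for $k=0,1,\dots,m$,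 $$E_{k1}=\frac{r^{m-k}}{1+r^{2m}}(-\cos k\theta\,E_1+\sin k\theta\,E_2),\qquad E_{k2}=\frac{r^{m-k}}{1+r^{2m}}(\sin k\theta\,E_1+\cos k\theta\,E_2),$$ for $\nu=1,\dots,m-1$, $$\tilde E_{\nu1}=\frac{r^{m+\nu}}{1+r^{2m}}(-\cos \nu\theta\,E_1-\sin \nu\theta\,E_2),\qquad \tilde E_{\nu2}=\frac{r^{m+\nu}}{1+r^{2m}}(-\sin \nu\theta\,E_1+\cos \nu\theta\,E_2),$$ and $$\tilde E_{m1}=\Big(0,\ \tfrac{r^{2m}-1}{r^{2m}+1},\ -\tfrac{2r^m\sin m\theta}{r^{2m}+1}\Big),\qquad \tilde E_{m2}=\Big(\tfrac{r^{2m}-1}{r^{2m}+1},\ 0,\ -\tfrac{2r^m\cos m\theta}{r^{2m}+1}\Big).$$ Then $U_m$ is nondegenerate: every bounded $C^2$ map $v$, tangent to $\mathbb S^2$ along $U_m$, with $L_{U_m}[v]=0$ is a real linear combination of the fields $E_{kj}$ ($0\le k\le m$), $\tilde E_{\nu j}$ ($1\le\nu\le m-1$) and $\tilde E_{mj}$ ($j=1,2$).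 Moreover $\ker L_{U_m}$ is exactly the real span of these fields, and $\dim_{\mathbb R}\ker L_{U_m}=4m+2$. -/

import Mathlib

open scoped InnerProductSpace Laplacian

namespace HarmonicMapKernel

noncomputable section

/-- The target space `ℝ³` with its Euclidean inner product. The plane `ℝ²` is identified with `ℂ`. -/
abbrev R3 : Type := EuclideanSpace ℝ (Fin 3)

/-- Inverse stereographic projection `ℂ → S² ∖ {(0,0,1)}`. -/
def stereo (w : ℂ) : R3 :=
  !₂[2 * w.re / (1 + ‖w‖ ^ 2), 2 * w.im / (1 + ‖w‖ ^ 2), (‖w‖ ^ 2 - 1) / (‖w‖ ^ 2 + 1)]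

/-- The standard `m`-corotational harmonic map `U_m(z) = S(z^m)`. -/
def U (m : ℕ) (z : ℂ) : R3 := stereo (z ^ m)

/-- Partial derivative `∂/∂x`. -/
def dx (u : ℂ → R3) (z : ℂ) : R3 := fderiv ℝ u z 1

/-- Partial derivative `∂/∂y`. -/
def dy (u : ℂ → R3) (z : ℂ) : R3 := fderiv ℝ u z Complex.I

/-- `∇u · ∇v = ∑ᵢ ∑ⱼ ∂ⱼuᵢ ∂ⱼvᵢ`; in particular `gradDot u u = |∇u|²`. -/
def gradDot (u v : ℂ → R3) (z : ℂ) : ℝ := ⟪dx u z, dx v z⟫_ℝ + ⟪dy u z, dy v z⟫_ℝ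

/-- The linearized operator `L_u[v] = Δv + |∇u|² v + 2 (∇u · ∇v) u`. -/
def linOp (u v : ℂ → R3) (z : ℂ) : R3 :=
  (Δ v) z + gradDot u u z • v z + (2 * gradDot u v z) • u z

/-- `v` is a vector field along `u`, tangent to the sphere: `v(z) ∈ T_{u(z)} S²` for every `z`. -/
def IsTangentAlong (u v : ℂ → R3) : Prop := ∀ z, ⟪u z, v z⟫_ℝ = 0

/-- `v` is of class `C²` and `|v| + |∂v| + |∂²v|` is bounded on the plane. -/
def IsC2Bounded (v : ℂ → R3) : Prop :=
  ContDiff ℝ 2 v ∧ ∃ C : ℝ, ∀ z, ‖v z‖ + ‖fderiv ℝ v z‖ + ‖iteratedFDeriv ℝ 2 v z‖ ≤ C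

theorem linOp_add (u : ℂ → R3) {v w : ℂ → R3} (hv : ContDiff ℝ 2 v) (hw : ContDiff ℝ 2 w)
    (z : ℂ) : linOp u (v + w) z = linOp u v z + linOp u w z := by
  have h1 := hv.contDiffAt.laplacian_add (x := z) hw.contDiffAt
  have h2 : fderiv ℝ (v + w) z = fderiv ℝ v z + fderiv ℝ w z :=
    fderiv_add (hv.differentiable (by norm_num) z) (hw.differentiable (by norm_num) z)
  simp only [linOp, gradDot, dx, dy, h1, h2, Pi.add_apply, add_apply,
    inner_add_right]
  module

theorem linOp_smul (u : ℂ → R3) {v : ℂ → R3} (hv : ContDiff ℝ 2 v) (c : ℝ)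
    (z : ℂ) : linOp u (c • v) z = c • linOp u v z := by
  have h1 := InnerProductSpace.laplacian_smul (x := z) c hv.contDiffAt
  have h2 : fderiv ℝ (c • v) z = c • fderiv ℝ v z :=
    fderiv_const_smul (hv.differentiable (by norm_num) z) c
  simp only [linOp, gradDot, dx, dy, h1, h2, Pi.smul_apply, smul_apply,
    inner_smul_right]
  module

/-- The bounded kernel
`ker L_u = {v ∈ C²_b(ℂ, TS²) : v(z) ∈ T_{u(z)} S² for all z, and L_u[v] = 0}`, a real vector
space. -/
def kerL (u : ℂ → R3) : Submodule ℝ (ℂ → R3) where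
  carrier := {v | IsC2Bounded v ∧ IsTangentAlong u v ∧ ∀ z, linOp u v z = 0}
  zero_mem' := by
    refine ⟨⟨contDiff_const, 0, fun z => ?_⟩, fun z => by simp, fun z => ?_⟩
    · have h1 : fderiv ℝ (0 : ℂ → R3) z = 0 := by simp
      have h2 : iteratedFDeriv ℝ 2 (0 : ℂ → R3) z = 0 := by
        have := congrFun (iteratedFDeriv_fun_zero (𝕜 := ℝ) (E := ℂ) (F := R3) (n := 2)) z
        exact this
      simp [h1, h2]
    · have h := linOp_smul u (v := 0) contDiff_const 0 z
      simpa using h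
  add_mem' := by
    rintro v w ⟨⟨hv, C, hC⟩, tv, lv⟩ ⟨⟨hw, D, hD⟩, tw, lw⟩
    refine ⟨⟨hv.add hw, C + D, fun z => ?_⟩, fun z => ?_, fun z => ?_⟩
    · have h1 : fderiv ℝ (v + w) z = fderiv ℝ v z + fderiv ℝ w z :=
        fderiv_add (hv.differentiable (by norm_num) z) (hw.differentiable (by norm_num) z)
      have h2 : iteratedFDeriv ℝ 2 (v + w) z
          = iteratedFDeriv ℝ 2 v z + iteratedFDeriv ℝ 2 w z :=
        iteratedFDeriv_add_apply hv.contDiffAt hw.contDiffAt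
      rw [h1, h2, Pi.add_apply]
      have := norm_add_le (v z) (w z)
      have := norm_add_le (fderiv ℝ v z) (fderiv ℝ w z)
      have := norm_add_le (iteratedFDeriv ℝ 2 v z) (iteratedFDeriv ℝ 2 w z)
      linarith [hC z, hD z]
    · rw [Pi.add_apply, inner_add_right, tv z, tw z, add_zero]
    · rw [linOp_add u hv hw, lv z, lw z, add_zero]
  smul_mem' := by
    rintro c v ⟨⟨hv, C, hC⟩, tv, lv⟩
    refine ⟨⟨contDiff_const.smul hv, |c| * C, fun z => ?_⟩, fun z => ?_, fun z => ?_⟩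
    · have h1 : fderiv ℝ (c • v) z = c • fderiv ℝ v z :=
        fderiv_const_smul (hv.differentiable (by norm_num) z) c
      have h2 : iteratedFDeriv ℝ 2 (c • v) z = c • iteratedFDeriv ℝ 2 v z :=
        iteratedFDeriv_const_smul_apply hv.contDiffAt
      rw [h1, h2, Pi.smul_apply, norm_smul, norm_smul, norm_smul, Real.norm_eq_abs]
      have := mul_le_mul_of_nonneg_left (hC z) (abs_nonneg c)
      linarith
    · rw [Pi.smul_apply, inner_smul_right, tv z, mul_zero]
    · rw [linOp_smul u hv, lv z, smul_zero]

/-! In the formulas below `(r, θ) = (‖z‖, arg z)` are the polar coordinates of `z`. -/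

/-- `Q_m(r) = π - 2 arctan(r^m)`. -/
def Q (m : ℕ) (r : ℝ) : ℝ := Real.pi - 2 * Real.arctan (r ^ m)

/-- `E₁ = (-sin mθ, cos mθ, 0)`. -/
def E1 (m : ℕ) (z : ℂ) : R3 := !₂[-Real.sin (m * z.arg), Real.cos (m * z.arg), 0]

/-- `E₂ = (cos mθ cos Q_m, sin mθ cos Q_m, -sin Q_m)`. -/
def E2 (m : ℕ) (z : ℂ) : R3 :=
  !₂[Real.cos (m * z.arg) * Real.cos (Q m ‖z‖), Real.sin (m * z.arg) * Real.cos (Q m ‖z‖),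
    -Real.sin (Q m ‖z‖)]

/-- `E_{k1} = r^{m-k} / (1 + r^{2m}) (-cos kθ E₁ + sin kθ E₂)`, for `k ≤ m`. -/
def Ek1 (m k : ℕ) (z : ℂ) : R3 :=
  (‖z‖ ^ (m - k) / (1 + ‖z‖ ^ (2 * m))) •
    (-Real.cos (k * z.arg) • E1 m z + Real.sin (k * z.arg) • E2 m z)

/-- `E_{k2} = r^{m-k} / (1 + r^{2m}) (sin kθ E₁ + cos kθ E₂)`, for `k ≤ m`. -/
def Ek2 (m k : ℕ) (z : ℂ) : R3 :=
  (‖z‖ ^ (m - k) / (1 + ‖z‖ ^ (2 * m))) •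
    (Real.sin (k * z.arg) • E1 m z + Real.cos (k * z.arg) • E2 m z)

/-- `Ẽ_{ν1} = r^{m+ν} / (1 + r^{2m}) (-cos νθ E₁ - sin νθ E₂)`, for `1 ≤ ν ≤ m - 1`. -/
def Et1 (m ν : ℕ) (z : ℂ) : R3 :=
  (‖z‖ ^ (m + ν) / (1 + ‖z‖ ^ (2 * m))) •
    (-Real.cos (ν * z.arg) • E1 m z - Real.sin (ν * z.arg) • E2 m z)

/-- `Ẽ_{ν2} = r^{m+ν} / (1 + r^{2m}) (-sin νθ E₁ + cos νθ E₂)`, for `1 ≤ ν ≤ m - 1`. -/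
def Et2 (m ν : ℕ) (z : ℂ) : R3 :=
  (‖z‖ ^ (m + ν) / (1 + ‖z‖ ^ (2 * m))) •
    (-Real.sin (ν * z.arg) • E1 m z + Real.cos (ν * z.arg) • E2 m z)

/-- `Ẽ_{m1} = (0, (r^{2m} - 1) / (r^{2m} + 1), -2 r^m sin mθ / (r^{2m} + 1))`. -/
def Em1 (m : ℕ) (z : ℂ) : R3 :=
  !₂[0, (‖z‖ ^ (2 * m) - 1) / (‖z‖ ^ (2 * m) + 1),
    -(2 * ‖z‖ ^ m * Real.sin (m * z.arg) / (‖z‖ ^ (2 * m) + 1))]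

/-- `Ẽ_{m2} = ((r^{2m} - 1) / (r^{2m} + 1), 0, -2 r^m cos mθ / (r^{2m} + 1))`. -/
def Em2 (m : ℕ) (z : ℂ) : R3 :=
  !₂[(‖z‖ ^ (2 * m) - 1) / (‖z‖ ^ (2 * m) + 1), 0,
    -(2 * ‖z‖ ^ m * Real.cos (m * z.arg) / (‖z‖ ^ (2 * m) + 1))]

/-- The finite set of the fields `E_{kj}` (`0 ≤ k ≤ m`), `Ẽ_{νj}` (`1 ≤ ν ≤ m - 1`) and `Ẽ_{mj}`,
where `j = 1, 2`. -/
def kernelFields (m : ℕ) : Set (ℂ → R3) :=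
  {v | ∃ k : ℕ, k ≤ m ∧ (v = Ek1 m k ∨ v = Ek2 m k)} ∪
  {v | ∃ ν : ℕ, 1 ≤ ν ∧ ν < m ∧ (v = Et1 m ν ∨ v = Et2 m ν)} ∪
  {Em1 m, Em2 m}

end

end HarmonicMapKernel

open HarmonicMapKernel

/-! Write `v = dS_w(f)` with `w = z ^ m`, so that `f : ℂ → ℂ` is the coordinate of `v` in the
stereographic chart. The map `S` is conformal with factor `2 / (1 + |w|²)`, so a bounded `v` means
`f = O(1 + |z|^{2m})` (`norm_stereoDiff`). In this coordinate the linearized operator only involves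
`∂̄f` (`linOp_stereoDiff`): with `ρ = 1 / (1 + |w|²)`, the equation `L v = 0` becomes `∂∂̄f = 2 w̄
w' ρ ∂̄f`, that is, `∂(ρ² ∂̄f) = 0`. Hence `∂̄f = (1 + |z|^{2m})² h̄` with `h` entire.

The heart of the proof is that the growth bound forces `h = 0` (`eq_zero_of_wirtingerBar_eq`).
Expanding the square and taking primitives of `h`, `z ^ m * h` and `z ^ (2 * m) * h` gives an
explicit particular solution, from which `f` differs by an entire function. On the circle `|z| = r`
the powers of `z̄` in it cancel against powers of `z`, leaving a quadratic polynomial in `x =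
r^{2m}` whose coefficients are entire. Cauchy's formula, applied to the conjugate of `f`, bounds
that quadratic at each fixed interior point by `O(x)`, so its leading coefficient vanishes, and with
it `h`.

Then `f` is entire of growth `|z|^{2m}`, so a polynomial of degree at most `2m`. Conversely, every
such polynomial gives a kernel field; the derivative bounds come from an algebra of bounded
functions stable under `∂` and `∂̄`. The listed fields have coordinates that are real multiples of
`i z^j` and `z^j`, or such monomials corrected by constants, and span all these polynomials over
`ℝ`; the dimension is `2(2m + 1)`. -/

namespace HarmonicMapKernel

/-! ### Entire functions: primitives, circle averages, polynomial growth -/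

open Complex Metric ComplexConjugate

/-- If the derivative of an entire function vanishing at `0` is divisible by `z ^ n`, the function
is divisible by `z ^ (n + 1)`. -/
theorem exists_eq_pow_succ_mul (n : ℕ) : ∀ {H h : ℂ → ℂ}, Differentiable ℂ h →
    (∀ z, HasDerivAt H (z ^ n * h z) z) → H 0 = 0 →
    ∃ G : ℂ → ℂ, Differentiable ℂ G ∧ ∀ z, H z = z ^ (n + 1) * G z := by
  have dslope_diff : ∀ {H : ℂ → ℂ}, Differentiable ℂ H → Differentiable ℂ (dslope H 0) := by
    intro H hH
    rw [← differentiableOn_univ] at hH ⊢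
    exact (Complex.differentiableOn_dslope Filter.univ_mem).2 hH
  have dslope_mul : ∀ {H : ℂ → ℂ}, H 0 = 0 → ∀ z, H z = z * dslope H 0 z := by
    intro H h0 z
    have := sub_smul_dslope H 0 z
    simp only [sub_zero, smul_eq_mul, h0] at this
    exact this.symm
  induction n with
  | zero =>
    intro H h hh hH h0
    exact ⟨dslope H 0, dslope_diff fun z => (hH z).differentiableAt,
      fun z => by simpa using dslope_mul h0 z⟩
  | succ n ih =>
    intro H h hh hH h0
    obtain ⟨G, hG, hHG⟩ := ih (H := H) (h := fun z => z * h z) (differentiable_id.mul hh)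
      (fun z => by convert hH z using 1; ring) h0
    -- Differentiating `H = z ^ (n + 1) * G` and cancelling `z ^ n` leaves a relation which extends
    -- to `0` by continuity and shows `G 0 = 0`; this yields one more factor `z`.
    have key : ∀ z, z ≠ 0 → ((n : ℂ) + 1) * G z = z * (h z - deriv G z) := by
      intro z hz
      have h1 : HasDerivAt H (((n + 1 : ℕ) : ℂ) * z ^ n * G z + z ^ (n + 1) * deriv G z) z := by
        rw [funext hHG]
        simpa using (hasDerivAt_pow (n + 1) z).fun_mul (hG z).hasDerivAt
      have h2 := h1.unique (hH z)
      have h3 : z ^ n * (((n : ℂ) + 1) * G z) = z ^ n * (z * (h z - deriv G z)) := by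
        push_cast at h2
        linear_combination h2
      exact mul_left_cancel₀ (pow_ne_zero n hz) h3
    have hG' : Continuous (deriv G) := (hG.contDiff (n := 1)).continuous_deriv le_rfl
    have hn : (n : ℂ) + 1 ≠ 0 := by exact_mod_cast n.succ_ne_zero
    have key' : (fun z => ((n : ℂ) + 1) * G z) = fun z => z * (h z - deriv G z) := by
      refine Continuous.ext_on (dense_compl_singleton (0 : ℂ)) ?_ ?_ fun z hz => key z hz
      · exact continuous_const.mul hG.continuous
      · exact continuous_id.mul (hh.continuous.sub hG')
    have hG0 : G 0 = 0 := by
      have := congrFun key' 0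
      simpa [hn] using this
    refine ⟨dslope G 0, dslope_diff hG, fun z => ?_⟩
    rw [hHG, dslope_mul hG0 z]
    ring

/-- The primitive vanishing at `0` inherits the zero of `z ^ n * h`, raised by one order. The factor
`z ^ n` is what later absorbs `conj z ^ n` on circles. -/
theorem exists_primitive_pow_mul {h : ℂ → ℂ} (hh : Differentiable ℂ h) (n : ℕ) :
    ∃ G : ℂ → ℂ, Differentiable ℂ G ∧
      ∀ z, HasDerivAt (fun z => z ^ (n + 1) * G z) (z ^ n * h z) z := by
  have hd : Differentiable ℂ fun z => z ^ n * h z := (differentiable_pow n).mul hh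
  obtain ⟨H, h0, hH⟩ := hd.isExactOn_univ.with_val_at 0 0
  obtain ⟨G, hG, hHG⟩ := exists_eq_pow_succ_mul n hh (fun z => hH z (Set.mem_univ z)) h0
  exact ⟨G, hG, fun z => by rw [← funext hHG]; exact hH z (Set.mem_univ z)⟩

theorem norm_circleAverage_le {F : ℂ → ℂ} {c : ℂ} {r M : ℝ}
    (hF : ∀ z ∈ sphere c |r|, ‖F z‖ ≤ M) : ‖Real.circleAverage F c r‖ ≤ M := by
  rw [Real.circleAverage_def, norm_smul, norm_inv, Real.norm_of_nonneg Real.two_pi_pos.le,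
    inv_mul_le_iff₀ Real.two_pi_pos]
  have := intervalIntegral.norm_integral_le_of_norm_le_const (a := 0) (b := 2 * Real.pi)
    (f := fun θ => F (circleMap c r θ)) (C := M) fun θ _ => hF _ (circleMap_mem_sphere' c r θ)
  rwa [sub_zero, abs_of_pos Real.two_pi_pos, mul_comm M] at this

/-- If the boundary values of the entire function `P` on a circle differ by an antiholomorphic
function from values bounded by `M`, then `P` is controlled inside the circle. -/
theorem norm_le_of_eqOn_sphere_conj_add {k P F : ℂ → ℂ} (hk : Differentiable ℂ k)
    (hP : Differentiable ℂ P) {r M : ℝ} {a : ℂ} (ha : ‖a‖ < r)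
    (hF : ∀ z ∈ sphere (0 : ℂ) r, F z = conj (k z) + P z)
    (hM : ∀ z ∈ sphere (0 : ℂ) r, ‖F z‖ ≤ M) :
    ‖P a‖ ≤ ‖k 0‖ + r / (r - ‖a‖) * M := by
  have hr : 0 < r := (norm_nonneg a).trans_lt ha
  have habs : |r| = r := abs_of_pos hr
  have hza : ∀ z ∈ sphere (0 : ℂ) r, z - a ≠ 0 := by
    intro z hz h
    rw [sub_eq_zero.1 h] at hz
    exact ha.ne (by simpa using hz)
  have hP1 : Real.circleAverage (fun z => z / (z - a) * P z) 0 r = P a := by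
    have := DiffContOnCl.circleAverage_smul_div (f := P) (c := 0) (R := r) (w := a)
      hP.diffContOnCl (by simpa [habs] using ha)
    simpa using this
  -- On the circle `r² = z z̄`, so the conjugate of the Cauchy kernel `z / (z - a)` is `r² / (r² - ā
  -- z)`, holomorphic on the closed disc since `|a| < r`. The antiholomorphic part therefore
  -- contributes to the Cauchy average only through its value at the centre.
  set K : ℂ → ℂ := fun z => (r : ℂ) ^ 2 / ((r : ℂ) ^ 2 - conj a * z) * k z with hKdef
  have hden : ∀ z : ℂ, ‖z‖ ≤ r → (r : ℂ) ^ 2 - conj a * z ≠ 0 := by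
    intro z hz h
    have h1 : ‖(r : ℂ) ^ 2‖ = ‖conj a * z‖ := by rw [sub_eq_zero.1 h]
    rw [norm_mul, norm_pow, Complex.norm_real, Real.norm_of_nonneg hr.le, RCLike.norm_conj] at h1
    nlinarith [norm_nonneg a, norm_nonneg z]
  have hK : DifferentiableOn ℂ K (closedBall 0 r) := by
    intro z hz
    have hz' : ‖z‖ ≤ r := by simpa using hz
    have : DifferentiableAt ℂ K z := by
      refine DifferentiableAt.mul (DifferentiableAt.div (by fun_prop) (by fun_prop) (hden z hz'))
        (hk z)
    exact this.differentiableWithinAt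
  have hKd : DiffContOnCl ℂ K (ball 0 |r|) := by
    rw [habs]
    exact DifferentiableOn.diffContOnCl (by rwa [closure_ball _ hr.ne'])
  have hK1 : Real.circleAverage K 0 r = k 0 := by
    rw [hKd.circleAverage]
    have : (r : ℂ) ≠ 0 := by exact_mod_cast hr.ne'
    simp [hKdef, this]
  have hKint : CircleIntegrable K 0 r :=
    (hK.continuousOn.mono sphere_subset_closedBall).circleIntegrable hr.le
  have hK2 : Real.circleAverage (fun z => conj (K z)) 0 r = conj (k 0) := by
    have := (conjCLE : ℂ →L[ℝ] ℂ).circleAverage_comp_comm hKint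
    rw [hK1] at this
    exact this
  have hconj : CircleIntegrable (fun z => conj (K z)) 0 r :=
    (Complex.continuous_conj.comp_continuousOn
      (hK.continuousOn.mono sphere_subset_closedBall)).circleIntegrable hr.le
  have hPint : CircleIntegrable (fun z => z / (z - a) * P z) 0 r := by
    refine ContinuousOn.circleIntegrable hr.le ?_
    exact (continuousOn_id.div (continuousOn_id.sub continuousOn_const) hza).mul
      hP.continuous.continuousOn
  have hsum : Real.circleAverage (fun z => z / (z - a) * F z) 0 r = conj (k 0) + P a := by
    rw [← hK2, ← hP1, ← Real.circleAverage_fun_add hconj hPint]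
    refine Real.circleAverage_congr_sphere fun z hz => ?_
    rw [habs] at hz
    have hz2 : (r : ℂ) ^ 2 = conj z * z := by
      rw [← Complex.normSq_eq_conj_mul_self, Complex.normSq_eq_norm_sq]
      rw [mem_sphere_zero_iff_norm.1 hz]
      push_cast
      rfl
    have hz0 : z ≠ 0 := by
      rintro rfl
      simp at hz
      exact hr.ne hz
    have h3 : conj z - conj a ≠ 0 := by
      rw [← map_sub]
      exact (map_ne_zero _).2 (hza z hz)
    have h4 : conj (K z) = z / (z - a) * conj (k z) := by
      have : K z = conj z / (conj z - conj a) * k z := by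
        have h5 : conj z * z - conj a * z ≠ 0 := by
          rw [← sub_mul]
          exact mul_ne_zero h3 hz0
        simp only [hKdef, hz2]
        congr 1
        field_simp
      rw [this]
      simp
    simp only [hF z hz, h4]
    ring
  have hbound : ‖conj (k 0) + P a‖ ≤ r / (r - ‖a‖) * M := by
    rw [← hsum]
    refine norm_circleAverage_le fun z hz => ?_
    rw [habs] at hz
    rw [norm_mul, norm_div]
    have hzr : ‖z‖ = r := by simpa using hz
    have h1 : r - ‖a‖ ≤ ‖z - a‖ := by
      rw [← hzr]
      exact norm_sub_norm_le z a
    rw [hzr]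
    have h2 : 0 < r - ‖a‖ := sub_pos.2 ha
    exact mul_le_mul (div_le_div_of_nonneg_left hr.le h2 h1) (hM z hz) (norm_nonneg _)
      (div_nonneg hr.le h2.le)
  have := norm_sub_le (conj (k 0) + P a) (conj (k 0))
  rw [add_sub_cancel_left, RCLike.norm_conj] at this
  linarith

/-- An entire function of polynomial growth is a polynomial. -/
theorem exists_eq_sum_of_growth {f : ℂ → ℂ} (hf : Differentiable ℂ f) {C : ℝ} {d : ℕ}
    (hC : ∀ z, ‖f z‖ ≤ C * (1 + ‖z‖ ^ d)) :
    ∃ c : Fin (d + 1) → ℂ, ∀ z, f z = ∑ i, c i * z ^ (i : ℕ) := by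
  have hC0 : 0 ≤ C := by
    have := (norm_nonneg _).trans (hC 0)
    rcases d with _ | d
    · simp at this; linarith
    · simpa using this
  have hvanish : ∀ n, d < n → iteratedDeriv n f 0 = 0 := by
    intro n hn
    by_contra hne
    set N := ‖iteratedDeriv n f 0‖ with hN
    have hNpos : 0 < N := norm_pos_iff.2 hne
    -- Cauchy's estimate on the circle of radius `R`: the growth `R ^ d` loses at least one power
    -- against `R ^ n`, so `N * R` stays bounded.
    have hbd : ∀ R : ℝ, 1 ≤ R → N * R ≤ n.factorial * (2 * C) := by
      intro R hR
      have hR0 : 0 < R := by linarith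
      have h1 := Complex.norm_iteratedDeriv_le_of_forall_mem_sphere_norm_le (c := 0) (R := R)
        (C := 2 * C * R ^ d) (f := f) n hR0 hf.diffContOnCl (by
          intro z hz
          rw [mem_sphere_zero_iff_norm] at hz
          have := hC z
          rw [hz] at this
          have h2 : 1 ≤ R ^ d := one_le_pow₀ hR
          nlinarith)
      rw [le_div_iff₀ (pow_pos hR0 n)] at h1
      have h3 : R ^ (d + 1) ≤ R ^ n := pow_le_pow_right₀ hR hn
      have h4 : N * R * R ^ d ≤ n.factorial * (2 * C) * R ^ d := by
        calc N * R * R ^ d = N * R ^ (d + 1) := by ring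
          _ ≤ N * R ^ n := mul_le_mul_of_nonneg_left h3 hNpos.le
          _ ≤ _ := by rw [mul_assoc]; exact h1
      exact le_of_mul_le_mul_right h4 (pow_pos hR0 d)
    have h5 := hbd (max 1 ((n.factorial * (2 * C) + 1) / N)) (le_max_left _ _)
    have h6 : n.factorial * (2 * C) + 1 ≤ N * max 1 ((n.factorial * (2 * C) + 1) / N) := by
      rw [← div_le_iff₀' hNpos]
      exact le_max_right _ _
    linarith
  refine ⟨fun i => ((i : ℕ).factorial : ℂ)⁻¹ * iteratedDeriv i f 0, fun z => ?_⟩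
  rw [← Complex.taylorSeries_eq_of_entire' 0 z hf,
    tsum_eq_sum (s := Finset.range (d + 1)), Finset.sum_range]
  · simp
  · intro n hn
    rw [hvanish n (by simpa using hn)]
    simp

end HarmonicMapKernel

/-! ### Wirtinger calculus -/

namespace HarmonicMapKernel

open Complex Metric ComplexConjugate

/-- `f` is real differentiable at `z` with Wirtinger derivatives `∂f = p` and `∂̄f = q`. -/
def HasWirtingerDerivAt (f : ℂ → ℂ) (p q z : ℂ) : Prop :=
  HasFDerivAt f (p • (1 : ℂ →L[ℝ] ℂ) + q • (conjCLE : ℂ →L[ℝ] ℂ)) z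

namespace HasWirtingerDerivAt

variable {f g : ℂ → ℂ} {p q p' q' z : ℂ}

theorem fderiv_apply (h : HasWirtingerDerivAt f p q z) (e : ℂ) :
    fderiv ℝ f z e = p * e + q * conj e := by
  rw [HasFDerivAt.fderiv h]
  simp

theorem congr_deriv (h : HasWirtingerDerivAt f p q z) (hp : p = p') (hq : q = q') :
    HasWirtingerDerivAt f p' q' z := hp ▸ hq ▸ h

theorem differentiableAt (h : HasWirtingerDerivAt f p q z) : DifferentiableAt ℝ f z :=
  HasFDerivAt.differentiableAt h

theorem unique (h : HasWirtingerDerivAt f p q z) (h' : HasWirtingerDerivAt f p' q' z) :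
    p = p' ∧ q = q' := by
  have h1 := (h.fderiv_apply 1).symm.trans (h'.fderiv_apply 1)
  have h2 := (h.fderiv_apply I).symm.trans (h'.fderiv_apply I)
  simp only [map_one, mul_one, conj_I] at h1 h2
  have h3 : p - q = p' - q' := mul_right_cancel₀ I_ne_zero (by linear_combination h2)
  constructor
  · linear_combination (h1 + h3) / 2
  · linear_combination (h1 - h3) / 2

theorem const (c : ℂ) : HasWirtingerDerivAt (fun _ => c) 0 0 z := by
  refine (hasFDerivAt_const (𝕜 := ℝ) c z).congr_fderiv ?_
  ext
  simp

theorem of_hasDerivAt (h : HasDerivAt f p z) : HasWirtingerDerivAt f p 0 z := by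
  have := (h.hasFDerivAt).restrictScalars ℝ
  refine this.congr_fderiv ?_
  ext
  simp [mul_comm]

theorem conj_comp (h : HasWirtingerDerivAt f p q z) :
    HasWirtingerDerivAt (fun z => conj (f z)) (conj q) (conj p) z := by
  have := (conjCLE : ℂ →L[ℝ] ℂ).hasFDerivAt.comp z h
  refine HasFDerivAt.congr_fderiv this ?_
  ext
  simp [add_comm]

theorem add (h : HasWirtingerDerivAt f p q z) (h' : HasWirtingerDerivAt g p' q' z) :
    HasWirtingerDerivAt (fun z => f z + g z) (p + p') (q + q') z := by
  refine (HasFDerivAt.fun_add h h').congr_fderiv ?_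
  module

theorem sub (h : HasWirtingerDerivAt f p q z) (h' : HasWirtingerDerivAt g p' q' z) :
    HasWirtingerDerivAt (fun z => f z - g z) (p - p') (q - q') z := by
  refine (HasFDerivAt.fun_sub h h').congr_fderiv ?_
  module

theorem mul (h : HasWirtingerDerivAt f p q z) (h' : HasWirtingerDerivAt g p' q' z) :
    HasWirtingerDerivAt (fun z => f z * g z) (p * g z + f z * p') (q * g z + f z * q') z := by
  refine (HasFDerivAt.fun_mul h h').congr_fderiv ?_
  ext
  simp
  ring

theorem const_mul (c : ℂ) (h : HasWirtingerDerivAt f p q z) :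
    HasWirtingerDerivAt (fun z => c * f z) (c * p) (c * q) z :=
  ((const c).mul h).congr_deriv (by simp) (by simp)

theorem comp_hasDerivAt {φ : ℂ → ℂ} {φ' : ℂ} (hφ : HasDerivAt φ φ' (f z))
    (h : HasWirtingerDerivAt f p q z) :
    HasWirtingerDerivAt (fun z => φ (f z)) (φ' * p) (φ' * q) z := by
  have := ((hφ.hasFDerivAt).restrictScalars ℝ).comp z h
  refine HasFDerivAt.congr_fderiv this ?_
  ext
  simp
  ring

theorem inv (h : HasWirtingerDerivAt f p q z) (h0 : f z ≠ 0) :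
    HasWirtingerDerivAt (fun z => (f z)⁻¹) (-(p * ((f z)⁻¹) ^ 2)) (-(q * ((f z)⁻¹) ^ 2)) z :=
  (comp_hasDerivAt (hasDerivAt_inv h0) h).congr_deriv (by field_simp) (by field_simp)

theorem differentiableAt_complex (h : HasWirtingerDerivAt f p 0 z) : DifferentiableAt ℂ f z := by
  rw [differentiableAt_complex_iff_differentiableAt_real]
  refine ⟨h.differentiableAt, ?_⟩
  rw [h.fderiv_apply, h.fderiv_apply]
  simp [mul_comm]

end HasWirtingerDerivAt

noncomputable section

/-- The Wirtinger derivative `∂f = (∂ₓf - i ∂_y f) / 2`. -/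
def wirtinger (f : ℂ → ℂ) (z : ℂ) : ℂ := (fderiv ℝ f z 1 - I * fderiv ℝ f z I) / 2

/-- The Wirtinger derivative `∂̄f = (∂ₓf + i ∂_y f) / 2`. -/
def wirtingerBar (f : ℂ → ℂ) (z : ℂ) : ℂ := (fderiv ℝ f z 1 + I * fderiv ℝ f z I) / 2

end

/-- Every real linear map of `ℂ` has the form `e ↦ p e + q ē`; its values at `1` and `I` determine
`p` and `q`. -/
theorem _root_.DifferentiableAt.hasWirtingerDerivAt {f : ℂ → ℂ} {z : ℂ}
    (h : DifferentiableAt ℝ f z) :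
    HasWirtingerDerivAt f (wirtinger f z) (wirtingerBar f z) z := by
  refine h.hasFDerivAt.congr_fderiv (ContinuousLinearMap.ext fun e => ?_)
  have he : fderiv ℝ f z e = e.re * fderiv ℝ f z 1 + e.im * fderiv ℝ f z I := by
    conv_lhs => rw [show e = e.re • (1 : ℂ) + e.im • I by simp [Complex.re_add_im]]
    rw [map_add, map_smul, map_smul, real_smul, real_smul]
  have h1 : conj e = e.re - e.im * I := by
    apply Complex.ext <;> simp
  simp only [wirtinger, wirtingerBar, add_apply, smul_apply, one_apply_eq_self,
    smul_eq_mul, ContinuousLinearEquiv.coe_coe, conjCLE_apply]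
  rw [he, h1]
  linear_combination (fderiv ℝ f z 1 - I * fderiv ℝ f z I) / 2 * Complex.re_add_im e
    + (fderiv ℝ f z I * e.im) * I_sq

theorem HasWirtingerDerivAt.eq_wirtinger {f : ℂ → ℂ} {p q z : ℂ}
    (h : HasWirtingerDerivAt f p q z) : wirtinger f z = p :=
  (h.differentiableAt.hasWirtingerDerivAt.unique h).1

theorem HasWirtingerDerivAt.eq_wirtingerBar {f : ℂ → ℂ} {p q z : ℂ}
    (h : HasWirtingerDerivAt f p q z) : wirtingerBar f z = q :=
  (h.differentiableAt.hasWirtingerDerivAt.unique h).2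

section SecondOrder

variable {f : ℂ → ℂ}

theorem _root_.ContDiff.wirtinger (hf : ContDiff ℝ 2 f) : ContDiff ℝ 1 (wirtinger f) := by
  have h := hf.fderiv_right (m := 1) (by norm_num)
  unfold HarmonicMapKernel.wirtinger
  fun_prop

theorem _root_.ContDiff.wirtingerBar (hf : ContDiff ℝ 2 f) : ContDiff ℝ 1 (wirtingerBar f) := by
  have h := hf.fderiv_right (m := 1) (by norm_num)
  unfold HarmonicMapKernel.wirtingerBar
  fun_prop

/-- Both identities follow from the symmetry of the second derivative: `∂` and `∂̄` commute, and `Δ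
= 4 ∂∂̄`. -/
theorem wirtinger_second_deriv (hf : ContDiff ℝ 2 f) (z : ℂ) :
    wirtingerBar (wirtinger f) z = wirtinger (wirtingerBar f) z ∧
      (Δ f) z = 4 * wirtinger (wirtingerBar f) z := by
  have hd : DifferentiableAt ℝ (fderiv ℝ f) z :=
    (hf.fderiv_right (m := 1) (by norm_num)).differentiable one_ne_zero z
  have happ : ∀ e e' : ℂ, fderiv ℝ (fun z => fderiv ℝ f z e) z e'
      = fderiv ℝ (fderiv ℝ f) z e' e := by
    intro e e'
    rw [fderiv_clm_apply hd (differentiableAt_const e)]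
    simp
  have hda : ∀ e : ℂ, DifferentiableAt ℝ (fun z => fderiv ℝ f z e) z := fun e =>
    hd.clm_apply (differentiableAt_const e)
  have hW : ∀ e', fderiv ℝ (wirtinger f) z e'
      = (fderiv ℝ (fderiv ℝ f) z e' 1 - I * fderiv ℝ (fderiv ℝ f) z e' I) / 2 := by
    intro e'
    have h1 := ((hda 1).hasFDerivAt.fun_sub ((hda I).hasFDerivAt.const_mul I)).const_mul (1 / 2 : ℂ)
    have h2 : wirtinger f = fun z => (1 / 2 : ℂ) * (fderiv ℝ f z 1 - I * fderiv ℝ f z I) := by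
      funext z; simp only [wirtinger]; ring
    rw [h2, h1.fderiv]
    simp only [smul_apply, sub_apply, happ, smul_eq_mul]
    ring
  have hWb : ∀ e', fderiv ℝ (wirtingerBar f) z e'
      = (fderiv ℝ (fderiv ℝ f) z e' 1 + I * fderiv ℝ (fderiv ℝ f) z e' I) / 2 := by
    intro e'
    have h1 := ((hda 1).hasFDerivAt.fun_add ((hda I).hasFDerivAt.const_mul I)).const_mul (1 / 2 : ℂ)
    have h2 : wirtingerBar f = fun z => (1 / 2 : ℂ) * (fderiv ℝ f z 1 + I * fderiv ℝ f z I) := by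
      funext z; simp only [wirtingerBar]; ring
    rw [h2, h1.fderiv]
    simp only [smul_apply, add_apply, happ, smul_eq_mul]
    ring
  have hsymm : fderiv ℝ (fderiv ℝ f) z I 1 = fderiv ℝ (fderiv ℝ f) z 1 I :=
    (hf.contDiffAt.isSymmSndFDerivAt (by simp)) I 1
  constructor
  · rw [wirtingerBar, wirtinger, hW, hW, hWb, hWb, hsymm]
    ring
  · rw [InnerProductSpace.laplacian_eq_iteratedFDeriv_complexPlane, wirtinger, hWb, hWb, hsymm]
    simp only [iteratedFDeriv_two_apply, Matrix.cons_val_zero, Matrix.cons_val_one]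
    linear_combination fderiv ℝ (fderiv ℝ f) z I I * I_sq

end SecondOrder

end HarmonicMapKernel

/-! ### Liouville theorem for the linearized equation -/

namespace HarmonicMapKernel

open Complex Metric ComplexConjugate

theorem one_add_mul_conj_ne_zero (w : ℂ) : 1 + w * conj w ≠ 0 := by
  rw [mul_conj, normSq_eq_norm_sq]
  exact_mod_cast (by positivity : (0 : ℝ) < 1 + ‖w‖ ^ 2).ne'

theorem hasWirtingerDerivAt_conj_pow (m : ℕ) (z : ℂ) :
    HasWirtingerDerivAt (fun z => conj (z ^ m)) 0 (conj (m * z ^ (m - 1))) z :=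
  (HasWirtingerDerivAt.of_hasDerivAt (hasDerivAt_pow m z)).conj_comp.congr_deriv (map_zero _) rfl

/-- The function `1 / (1 + |ω|²)`. -/
noncomputable def density (ω : ℂ) : ℂ := (1 + ω * conj ω)⁻¹

theorem density_mul (ω : ℂ) : density ω * (1 + ω * conj ω) = 1 :=
  inv_mul_cancel₀ (one_add_mul_conj_ne_zero _)

theorem conj_density (ω : ℂ) : conj (density ω) = density ω := by
  simp [density, mul_comm]

theorem hasWirtingerDerivAt_density {w : ℂ → ℂ} {w' z : ℂ} (hw : HasDerivAt w w' z) :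
    HasWirtingerDerivAt (fun z => density (w z)) (-(w' * conj (w z) * density (w z) ^ 2))
      (-(w z * conj w' * density (w z) ^ 2)) z := by
  have hw' := HasWirtingerDerivAt.of_hasDerivAt hw
  have h := ((HasWirtingerDerivAt.const 1).add (hw'.mul hw'.conj_comp)).inv
    (one_add_mul_conj_ne_zero (w z))
  refine h.congr_deriv ?_ ?_ <;> simp [density]

/-- A function of growth `O(|z|^{2m})` with `∂̄f = (1 + |z|^{2m})² h̄`, `h` entire, satisfies
`h = 0`. -/
theorem eq_zero_of_wirtingerBar_eq {m : ℕ} (hm : 1 ≤ m) {f h p : ℂ → ℂ} (hh : Differentiable ℂ h)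
    (hf : ∀ z, HasWirtingerDerivAt f (p z) ((1 + z ^ m * conj (z ^ m)) ^ 2 * conj (h z)) z)
    {C : ℝ} (hC : ∀ z, ‖f z‖ ≤ C * (1 + ‖z‖ ^ (2 * m))) : ∀ z, h z = 0 := by
  obtain ⟨G0, hG0, hH0⟩ := exists_primitive_pow_mul hh 0
  obtain ⟨G1, hG1, hH1⟩ := exists_primitive_pow_mul hh m
  obtain ⟨G2, hG2, hH2⟩ := exists_primitive_pow_mul hh (2 * m)
  -- Antiderivative for `∂` of `(1 + |z|^{2m})² h`, term by term after expanding the square: powers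
  -- of `z̄` are constants for `∂`.
  set A : ℂ → ℂ := fun z => z ^ (0 + 1) * G0 z + 2 * (conj (z ^ m) * (z ^ (m + 1) * G1 z))
    + conj (z ^ (2 * m)) * (z ^ (2 * m + 1) * G2 z) with hA
  have hAd : ∀ z, ∃ q, HasWirtingerDerivAt A ((1 + z ^ m * conj (z ^ m)) ^ 2 * h z) q z := by
    intro z
    refine ⟨_, ((((HasWirtingerDerivAt.of_hasDerivAt (hH0 z)).add
      (((hasWirtingerDerivAt_conj_pow m z).mul (.of_hasDerivAt (hH1 z))).const_mul 2)).add
      ((hasWirtingerDerivAt_conj_pow (2 * m) z).mul (.of_hasDerivAt (hH2 z))))).congr_deriv ?_ rfl⟩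
    simp only [map_pow]
    ring
  set k : ℂ → ℂ := fun z => f z - conj (A z) with hk
  have hkd : Differentiable ℂ k := by
    intro z
    obtain ⟨q, hq⟩ := hAd z
    have := (hf z).sub hq.conj_comp
    refine (this.congr_deriv rfl (q' := 0) ?_).differentiableAt_complex
    simp only [map_mul, map_pow, map_add, map_one, conj_conj]
    ring
  have hC0 : 0 ≤ C := by
    have := (norm_nonneg _).trans (hC 0)
    simpa [show m ≠ 0 by omega] using this
  -- At a fixed point `a` the radius tends to infinity: the term `x² a G2(a)` is bounded by a
  -- multiple of `x`, with `x = r^{2m}`.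
  have hG2zero : ∀ a, a * G2 a = 0 := by
    intro a
    by_contra hne
    set N := ‖a * G2 a‖ with hN
    have hNpos : 0 < N := norm_pos_iff.2 hne
    set K := ‖k 0‖ + 2 * C + ‖a * G0 a‖ + 2 * ‖a * G1 a‖ + 2 * C with hK
    have hbd : ∀ r : ℝ, 1 ≤ r → 2 * ‖a‖ < r → N * r ≤ 2 * K := by
      intro r hr1 hra
      have hr0 : 0 < r := by linarith
      have har : ‖a‖ < r := by linarith [norm_nonneg a]
      set x := r ^ (2 * m) with hx
      have hx1 : 1 ≤ x := one_le_pow₀ hr1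
      have hrx : r ≤ x := le_self_pow₀ hr1 (by omega)
      -- `P` is `A` with each `(z z̄) ^ m` frozen to its value `x` on the circle; it is entire and
      -- agrees with `A` there, so `f̄ = k̄ + P` on the circle.
      have h1 := norm_le_of_eqOn_sphere_conj_add (k := k)
        (P := fun z => z * (G0 z + 2 * (x : ℂ) * G1 z + (x : ℂ) ^ 2 * G2 z))
        (F := fun z => conj (f z)) (r := r) (M := C * (1 + x)) (a := a) hkd (by fun_prop) har
        (by
          intro z hz
          have hzr : conj z * z = (r : ℂ) ^ 2 := by
            rw [mul_comm, mul_conj, normSq_eq_norm_sq, mem_sphere_zero_iff_norm.1 hz]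
            push_cast
            rfl
          have hzm : conj z ^ m * z ^ m = (x : ℂ) := by
            rw [← mul_pow, hzr, hx, ← pow_mul]
            push_cast
            rfl
          simp only [hk, hA, map_sub, conj_conj, map_pow]
          rw [← hzm]
          ring)
        (by
          intro z hz
          rw [RCLike.norm_conj]
          have := hC z
          rwa [mem_sphere_zero_iff_norm.1 hz] at this)
      have h2 : r / (r - ‖a‖) ≤ 2 := by
        rw [div_le_iff₀ (by linarith)]
        linarith
      have h3 : r / (r - ‖a‖) * (C * (1 + x)) ≤ 2 * (C * (1 + x)) :=
        mul_le_mul_of_nonneg_right h2 (by positivity)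
      have h4 : N * x ^ 2 ≤ ‖a * (G0 a + 2 * (x : ℂ) * G1 a + (x : ℂ) ^ 2 * G2 a)‖
          + ‖a * G0 a‖ + 2 * x * ‖a * G1 a‖ := by
        have e1 : (x : ℂ) ^ 2 * (a * G2 a) = a * (G0 a + 2 * (x : ℂ) * G1 a + (x : ℂ) ^ 2 * G2 a)
          - a * G0 a - 2 * (x : ℂ) * (a * G1 a) := by ring
        have e2 : ‖(x : ℂ) ^ 2 * (a * G2 a)‖ = N * x ^ 2 := by
          rw [norm_mul, norm_pow, norm_real, Real.norm_of_nonneg (by linarith), mul_comm]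
        have e3 : ‖2 * (x : ℂ) * (a * G1 a)‖ = 2 * x * ‖a * G1 a‖ := by
          rw [norm_mul, norm_mul, norm_real, Real.norm_of_nonneg (by linarith)]
          simp
        rw [← e2, e1, ← e3]
        exact (norm_sub_le _ _).trans (add_le_add_left (norm_sub_le _ _) _)
      have h5 : N * x ^ 2 ≤ K * (2 * x) := by
        have p1 := norm_nonneg (k 0)
        have p2 := norm_nonneg (a * G0 a)
        have p3 := norm_nonneg (a * G1 a)
        rw [hK]
        nlinarith
      have h6 : N * x ≤ 2 * K := by
        refine le_of_mul_le_mul_right ?_ (by linarith : 0 < x)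
        linarith
      exact (mul_le_mul_of_nonneg_left hrx hNpos.le).trans h6
    set r := max (max 1 (2 * ‖a‖ + 1)) ((2 * K + 1) / N) with hr
    have h5 := hbd r ((le_max_left _ _).trans (le_max_left _ _))
      (lt_of_lt_of_le (by linarith) ((le_max_right _ _).trans (le_max_left _ _)))
    have h6 : 2 * K + 1 ≤ N * r := by
      rw [← div_le_iff₀' hNpos]
      exact le_max_right _ _
    linarith
  have hH2zero : ∀ z : ℂ, z ^ (2 * m) * h z = 0 := by
    intro z
    have h0 : (fun z => z ^ (2 * m + 1) * G2 z) = fun _ => 0 := by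
      funext z
      rw [pow_succ, mul_assoc, hG2zero, mul_zero]
    have := hH2 z
    rw [h0] at this
    exact this.unique (hasDerivAt_const z 0)
  have : h = fun _ => 0 := by
    refine Continuous.ext_on (dense_compl_singleton (0 : ℂ)) hh.continuous continuous_const ?_
    intro z hz
    exact (mul_eq_zero.1 (hH2zero z)).resolve_left (pow_ne_zero _ hz)
  exact fun z => congrFun this z

/-- The Liouville theorem for the linearized equation in the stereographic coordinate. -/
theorem exists_eq_sum_of_linearized {m : ℕ} (hm : 1 ≤ m) {f : ℂ → ℂ} (hf : ContDiff ℝ 2 f)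
    (heq : ∀ z, wirtinger (wirtingerBar f) z
      = 2 * conj (z ^ m) * (m * z ^ (m - 1)) * density (z ^ m) * wirtingerBar f z)
    {C : ℝ} (hC : ∀ z, ‖f z‖ ≤ C * (1 + ‖z‖ ^ (2 * m))) :
    ∃ c : Fin (2 * m + 1) → ℂ, ∀ z, f z = ∑ i, c i * z ^ (i : ℕ) := by
  have hfd : ∀ z, HasWirtingerDerivAt f (wirtinger f z) (wirtingerBar f z) z := fun z =>
    (hf.differentiable two_ne_zero z).hasWirtingerDerivAt
  have hqd : ∀ z, HasWirtingerDerivAt (wirtingerBar f) (wirtinger (wirtingerBar f) z)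
      (wirtingerBar (wirtingerBar f) z) z := fun z =>
    (hf.wirtingerBar.differentiable one_ne_zero z).hasWirtingerDerivAt
  -- Since `∂ρ = -w' w̄ ρ²`, the equation says `∂(ρ² ∂̄f) = 0`; the conjugate of `ρ² ∂̄f` is thus
  -- entire.
  set h : ℂ → ℂ := fun z => conj (wirtingerBar f z * (density (z ^ m) * density (z ^ m))) with hh
  have hhd : Differentiable ℂ h := by
    intro z
    have hs := hasWirtingerDerivAt_density (hasDerivAt_pow m z)
    have := ((hqd z).mul (hs.mul hs)).conj_comp
    refine (this.congr_deriv rfl (q' := 0) ?_).differentiableAt_complex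
    rw [(map_eq_zero _), heq z]
    ring
  have hconj : ∀ z, wirtingerBar f z = (1 + z ^ m * conj (z ^ m)) ^ 2 * conj (h z) := by
    intro z
    simp only [hh, conj_conj]
    linear_combination (-wirtingerBar f z * (density (z ^ m) * (1 + z ^ m * conj (z ^ m)) + 1)) *
      density_mul (z ^ m)
  have hzero := eq_zero_of_wirtingerBar_eq hm hhd (p := wirtinger f)
    (fun z => (hfd z).congr_deriv rfl (hconj z)) hC
  refine exists_eq_sum_of_growth (fun z => ?_) hC
  refine ((hfd z).congr_deriv rfl (q' := 0) ?_).differentiableAt_complex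
  rw [hconj z, hzero z]
  simp

end HarmonicMapKernel

/-! ### The linearized operator in the stereographic coordinate -/

namespace HarmonicMapKernel

open Complex ComplexConjugate

noncomputable section

/-- The real linear map `ℂ × ℂ → ℝ³`, `(a, t) ↦ (Re a, Im a, Re t)`. -/
def assemble : ℂ × ℂ →L[ℝ] R3 :=
  LinearMap.toContinuousLinearMap
    { toFun := fun p => !₂[p.1.re, p.1.im, p.2.re]
      map_add' := fun p q => by ext i; fin_cases i <;> simp
      map_smul' := fun c p => by ext i; fin_cases i <;> simp }

theorem assemble_apply (a t : ℂ) : assemble (a, t) = !₂[a.re, a.im, t.re] := rfl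

theorem inner_assemble (a t a' t' : ℂ) :
    ⟪assemble (a, t), assemble (a', t')⟫_ℝ = (a * conj a').re + t.re * t'.re := by
  simp [assemble_apply, PiLp.inner_apply, Fin.sum_univ_three]
  ring

theorem smul_assemble (c : ℝ) (a t : ℂ) : c • assemble (a, t) = assemble (c * a, c * t) := by
  rw [← map_smul, Prod.smul_mk, real_smul, real_smul]

section Pair

variable {a t : ℂ → ℂ} {a₁ a₂ t₁ t₂ z : ℂ}

theorem fderiv_assemble (ha : HasWirtingerDerivAt a a₁ a₂ z) (ht : HasWirtingerDerivAt t t₁ t₂ z)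
    (e : ℂ) : fderiv ℝ (fun z => assemble (a z, t z)) z e
      = assemble (a₁ * e + a₂ * conj e, t₁ * e + t₂ * conj e) := by
  have h := assemble.hasFDerivAt.comp z
    (ha.differentiableAt.hasFDerivAt.prodMk ht.differentiableAt.hasFDerivAt)
  have h' : HasFDerivAt (fun z => assemble (a z, t z)) _ z := h
  rw [h'.fderiv, ← ha.fderiv_apply, ← ht.fderiv_apply]
  rfl

/-- The hypotheses on `t` and `t'` express that these heights have real differential: the `∂̄`
derivative is the conjugate of the `∂` derivative. The real number is cast to `ℂ` so that later
identities are polynomial in conjugate pairs. -/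
theorem gradDot_assemble {a' t' : ℂ → ℂ} {a₁' a₂' t₁' : ℂ}
    (ha : HasWirtingerDerivAt a a₁ a₂ z) (ht : HasWirtingerDerivAt t t₁ (conj t₁) z)
    (ha' : HasWirtingerDerivAt a' a₁' a₂' z) (ht' : HasWirtingerDerivAt t' t₁' (conj t₁') z) :
    ((gradDot (fun z => assemble (a z, t z)) (fun z => assemble (a' z, t' z)) z : ℝ) : ℂ)
      = a₁ * conj a₁' + conj a₁ * a₁' + a₂ * conj a₂' + conj a₂ * a₂'
        + 2 * (t₁ * conj t₁' + conj t₁ * t₁') := by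
  simp only [gradDot, dx, dy, fderiv_assemble ha ht, fderiv_assemble ha' ht', inner_assemble]
  apply Complex.ext <;> simp <;> ring

theorem laplacian_assemble (ha : ContDiff ℝ 2 a) (ht : ContDiff ℝ 2 t) (z : ℂ) :
    (Δ fun z => assemble (a z, t z)) z
      = assemble (4 * wirtinger (wirtingerBar a) z, 4 * wirtinger (wirtingerBar t) z) := by
  have h1 : ContDiff ℝ 2 fun z => (a z, t z) := ha.prodMk ht
  have h2 := h1.contDiffAt.laplacian_CLM_comp_left (x := z) (l := assemble)
  have h3 : (Δ fun z => (a z, t z)) z = ((Δ a) z, (Δ t) z) := by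
    have e1 := h1.contDiffAt.laplacian_CLM_comp_left (x := z) (l := ContinuousLinearMap.fst ℝ ℂ ℂ)
    have e2 := h1.contDiffAt.laplacian_CLM_comp_left (x := z) (l := ContinuousLinearMap.snd ℝ ℂ ℂ)
    exact Prod.ext e1.symm e2.symm
  rw [← (wirtinger_second_deriv ha z).2, ← (wirtinger_second_deriv ht z).2, ← h3]
  exact h2

end Pair

theorem stereo_eq_assemble (ω : ℂ) :
    stereo ω = assemble (2 * density ω * ω, 1 - 2 * density ω) := by
  have h : density ω = ((1 + ‖ω‖ ^ 2)⁻¹ : ℝ) := by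
    rw [density, mul_conj, normSq_eq_norm_sq]
    push_cast
    rfl
  have h0 : 1 + ‖ω‖ ^ 2 ≠ 0 := by positivity
  have h1 : ‖ω‖ ^ 2 + 1 ≠ 0 := by positivity
  rw [assemble_apply, stereo, h]
  ext i
  fin_cases i
  · simp [-ofReal_inv]; field_simp
  · simp [-ofReal_inv]; field_simp
  · simp [-ofReal_inv]; field_simp; ring

/-- The differential of the inverse stereographic projection at `ω`, applied to `f`. -/
def stereoDiff (ω f : ℂ) : R3 :=
  assemble (2 * density ω ^ 2 * (f - ω ^ 2 * conj f),
    2 * density ω ^ 2 * (conj ω * f + ω * conj f))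

theorem inner_stereo_stereoDiff (ω f : ℂ) : ⟪stereo ω, stereoDiff ω f⟫_ℝ = 0 := by
  rw [stereo_eq_assemble, stereoDiff, inner_assemble]
  have h1 := density_mul ω
  have hre : ∀ x : ℂ, ((x.re : ℝ) : ℂ) = (x + conj x) / 2 := by
    intro x; rw [re_eq_add_conj]
  apply ofReal_injective
  push_cast
  simp only [hre, map_mul, map_sub, map_add, map_pow, conj_conj, conj_density, map_one, map_ofNat]
  simp only [density] at h1 ⊢
  have := one_add_mul_conj_ne_zero ω
  field_simp
  ring

/-- The linearized operator in the stereographic coordinate. -/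
theorem linOp_stereoDiff {w w₁ w₂ f : ℂ → ℂ} (hw : ∀ z, HasDerivAt w (w₁ z) z)
    (hw₁ : ∀ z, HasDerivAt w₁ (w₂ z) z) (hwc : ContDiff ℝ 2 fun z => density (w z))
    (hwc' : ContDiff ℝ 2 w)
    (hf : ContDiff ℝ 2 f) (z : ℂ) :
    linOp (fun z => stereo (w z)) (fun z => stereoDiff (w z) (f z)) z
      = stereoDiff (w z) (4 * wirtinger (wirtingerBar f) z
        - 8 * conj (w z) * w₁ z * density (w z) * wirtingerBar f z) := by
  have hconj : ∀ {g : ℂ → ℂ}, ContDiff ℝ 2 g → ContDiff ℝ 2 fun z => conj (g z) := fun hg =>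
    (conjCLE : ℂ →L[ℝ] ℂ).contDiff.comp hg
  have hf1 : ∀ z, HasWirtingerDerivAt f (wirtinger f z) (wirtingerBar f z) z := fun z =>
    (hf.differentiable two_ne_zero z).hasWirtingerDerivAt
  have hp : HasWirtingerDerivAt (wirtinger f) (wirtinger (wirtinger f) z)
      (wirtinger (wirtingerBar f) z) z :=
    (hf.wirtinger.differentiable one_ne_zero z).hasWirtingerDerivAt.congr_deriv rfl
      (wirtinger_second_deriv hf z).1
  have hq : HasWirtingerDerivAt (wirtingerBar f) (wirtinger (wirtingerBar f) z)
      (wirtingerBar (wirtingerBar f) z) z :=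
    (hf.wirtingerBar.differentiable one_ne_zero z).hasWirtingerDerivAt
  have hW : ∀ z, HasWirtingerDerivAt w (w₁ z) 0 z := fun z => .of_hasDerivAt (hw z)
  have hW1 : HasWirtingerDerivAt w₁ (w₂ z) 0 z := .of_hasDerivAt (hw₁ z)
  have hs := fun z => hasWirtingerDerivAt_density (hw z)
  -- the components of the sphere-valued map
  have hUa : HasWirtingerDerivAt (fun z => 2 * density (w z) * w z)
      (2 * w₁ z * density (w z) ^ 2) (-(2 * w z ^ 2 * conj (w₁ z) * density (w z) ^ 2)) z := by
    refine (((hs z).const_mul 2).mul (hW z)).congr_deriv ?_ ?_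
    · linear_combination (-2 * w₁ z * density (w z)) * density_mul (w z)
    · ring
  have hUt : HasWirtingerDerivAt (fun z => 1 - 2 * density (w z))
      (2 * w₁ z * conj (w z) * density (w z) ^ 2)
      (conj (2 * w₁ z * conj (w z) * density (w z) ^ 2)) z := by
    refine ((HasWirtingerDerivAt.const 1).sub ((hs z).const_mul 2)).congr_deriv ?_ ?_
    · ring
    · simp only [map_mul, map_pow, conj_conj, conj_density, map_ofNat]
      ring
  -- the components of the vector field
  have hs2 := fun z => ((hs z).mul (hs z)).const_mul 2
  have hVa : ∀ z, HasWirtingerDerivAt (fun z => 2 * density (w z) ^ 2 * (f z - w z ^ 2 * conj (f z)))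
      (-(4 * w₁ z * conj (w z) * density (w z) ^ 3 * (f z - w z ^ 2 * conj (f z)))
        + 2 * density (w z) ^ 2 * (wirtinger f z - 2 * w z * w₁ z * conj (f z)
          - w z ^ 2 * conj (wirtingerBar f z)))
      (-(4 * w z * conj (w₁ z) * density (w z) ^ 3 * (f z - w z ^ 2 * conj (f z)))
        + 2 * density (w z) ^ 2 * (wirtingerBar f z - w z ^ 2 * conj (wirtinger f z))) z := by
    intro z
    have h := (hs2 z).mul ((hf1 z).sub (((hW z).mul (hW z)).mul (hf1 z).conj_comp))
    simp only [← pow_two] at h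
    refine h.congr_deriv ?_ ?_ <;> ring
  have hVt : ∀ z, HasWirtingerDerivAt
      (fun z => 2 * density (w z) ^ 2 * (conj (w z) * f z + w z * conj (f z)))
      (-(4 * w₁ z * conj (w z) * density (w z) ^ 3 * (conj (w z) * f z + w z * conj (f z)))
        + 2 * density (w z) ^ 2 * (conj (w z) * wirtinger f z + w₁ z * conj (f z)
          + w z * conj (wirtingerBar f z)))
      (-(4 * w z * conj (w₁ z) * density (w z) ^ 3 * (conj (w z) * f z + w z * conj (f z)))
        + 2 * density (w z) ^ 2 * (conj (w₁ z) * f z + conj (w z) * wirtingerBar f z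
          + w z * conj (wirtinger f z))) z := by
    intro z
    have h := (hs2 z).mul (((hW z).conj_comp.mul (hf1 z)).add ((hW z).mul (hf1 z).conj_comp))
    simp only [← pow_two] at h
    refine h.congr_deriv ?_ ?_ <;> simp only [map_zero, zero_mul] <;> ring
  have hs3 := ((hs z).mul ((hs z).mul (hs z))).const_mul 4
  have hVaa : wirtinger (wirtingerBar fun z => 2 * density (w z) ^ 2 *
        (f z - w z ^ 2 * conj (f z))) z
      = -(4 * w₁ z * conj (w₁ z) * density (w z) ^ 3 * (1 - 3 * w z * conj (w z) * density (w z))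
          * (f z - w z ^ 2 * conj (f z)))
        - 4 * w z * conj (w₁ z) * density (w z) ^ 3 * (wirtinger f z - 2 * w z * w₁ z * conj (f z)
          - w z ^ 2 * conj (wirtingerBar f z))
        - 4 * w₁ z * conj (w z) * density (w z) ^ 3
          * (wirtingerBar f z - w z ^ 2 * conj (wirtinger f z))
        + 2 * density (w z) ^ 2 * (wirtinger (wirtingerBar f) z
          - 2 * w z * w₁ z * conj (wirtinger f z)
          - w z ^ 2 * conj (wirtinger (wirtingerBar f) z)) := by
    -- Squares and cubes are written as products so that the product rule for Wirtinger derivatives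
    -- applies directly.
    have e : (wirtingerBar fun z => 2 * density (w z) ^ 2 * (f z - w z ^ 2 * conj (f z)))
        = fun z => 2 * (density (w z) * density (w z)) * (wirtingerBar f z
            - w z * w z * conj (wirtinger f z))
          - 4 * (density (w z) * (density (w z) * density (w z))) * (w z * conj (w₁ z)
            * (f z - w z * w z * conj (f z))) := by
      funext z
      rw [(hVa z).eq_wirtingerBar]
      ring
    have h := ((hs2 z).mul (hq.sub (((hW z).mul (hW z)).mul hp.conj_comp))).sub
      (hs3.mul (((hW z).mul hW1.conj_comp).mul
        ((hf1 z).sub (((hW z).mul (hW z)).mul (hf1 z).conj_comp))))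
    rw [e, h.eq_wirtinger]
    simp only [map_zero]
    ring
  have hVtt : wirtinger (wirtingerBar fun z => 2 * density (w z) ^ 2 *
        (conj (w z) * f z + w z * conj (f z))) z
      = -(4 * w₁ z * conj (w₁ z) * density (w z) ^ 3 * (1 - 3 * w z * conj (w z) * density (w z))
          * (conj (w z) * f z + w z * conj (f z)))
        - 4 * w z * conj (w₁ z) * density (w z) ^ 3 * (conj (w z) * wirtinger f z
          + w₁ z * conj (f z) + w z * conj (wirtingerBar f z))
        - 4 * w₁ z * conj (w z) * density (w z) ^ 3 * (conj (w₁ z) * f z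
          + conj (w z) * wirtingerBar f z + w z * conj (wirtinger f z))
        + 2 * density (w z) ^ 2 * (conj (w₁ z) * wirtinger f z
          + conj (w z) * wirtinger (wirtingerBar f) z + w₁ z * conj (wirtinger f z)
          + w z * conj (wirtinger (wirtingerBar f) z)) := by
    have e : (wirtingerBar fun z => 2 * density (w z) ^ 2 * (conj (w z) * f z + w z * conj (f z)))
        = fun z => 2 * (density (w z) * density (w z)) * (conj (w₁ z) * f z
            + conj (w z) * wirtingerBar f z + w z * conj (wirtinger f z))
          - 4 * (density (w z) * (density (w z) * density (w z))) * (w z * conj (w₁ z)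
            * (conj (w z) * f z + w z * conj (f z))) := by
      funext z
      rw [(hVt z).eq_wirtingerBar]
      ring
    have h := ((hs2 z).mul (((hW1.conj_comp.mul (hf1 z)).add ((hW z).conj_comp.mul hq)).add
      ((hW z).mul hp.conj_comp))).sub
      (hs3.mul (((hW z).mul hW1.conj_comp).mul
        (((hW z).conj_comp.mul (hf1 z)).add ((hW z).mul (hf1 z).conj_comp))))
    rw [e, h.eq_wirtinger]
    simp only [map_zero]
    ring
  -- The third component is real, so its `∂̄` derivative is the conjugate of its `∂` derivative, as
  -- `gradDot_assemble` requires.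
  have hVt' := (hVt z).congr_deriv rfl (q' := conj
    (-(4 * w₁ z * conj (w z) * density (w z) ^ 3 * (conj (w z) * f z + w z * conj (f z)))
        + 2 * density (w z) ^ 2 * (conj (w z) * wirtinger f z + w₁ z * conj (f z)
          + w z * conj (wirtingerBar f z)))) (by
    simp only [map_mul, map_add, map_neg, map_pow, conj_conj, conj_density, map_ofNat]
    ring)
  have hca : ContDiff ℝ 2 fun z => 2 * density (w z) ^ 2 * (f z - w z ^ 2 * conj (f z)) :=
    (contDiff_const.mul (hwc.pow 2)).mul (hf.sub ((hwc'.pow 2).mul (hconj hf)))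
  have hct : ContDiff ℝ 2 fun z => 2 * density (w z) ^ 2 * (conj (w z) * f z + w z * conj (f z)) :=
    (contDiff_const.mul (hwc.pow 2)).mul (((hconj hwc').mul hf).add (hwc'.mul (hconj hf)))
  have hg1 := gradDot_assemble hUa hUt hUa hUt
  have hg2 := gradDot_assemble hUa hUt (hVa z) hVt'
  simp only [linOp, stereo_eq_assemble, stereoDiff, laplacian_assemble hca hct, smul_assemble,
    ← map_add, Prod.mk_add_mk, hVaa, hVtt]
  have hσ := one_add_mul_conj_ne_zero (w z)
  congr 2
  · push_cast
    rw [hg1, hg2]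
    simp only [map_mul, map_add, map_sub, map_neg, map_pow, conj_conj, conj_density, map_ofNat]
    simp only [density]
    -- With `w` and `w̄` treated as independent variables, the claim is a rational identity with
    -- denominators powers of `1 + w b`.
    generalize conj (w z) = b at *
    field_simp
    ring
  · push_cast
    rw [hg1, hg2]
    simp only [map_mul, map_add, map_sub, map_neg, map_pow, conj_conj, conj_density, map_ofNat]
    simp only [density]
    generalize conj (w z) = b at *
    field_simp
    ring

end

end HarmonicMapKernel

/-! ### Recovering the coordinate from a tangent field -/

namespace HarmonicMapKernel

open Complex ComplexConjugate

noncomputable section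

theorem density_eq_ofReal (ω : ℂ) : density ω = ((1 + ‖ω‖ ^ 2)⁻¹ : ℝ) := by
  rw [density, mul_conj, normSq_eq_norm_sq]
  push_cast
  rfl

theorem coord_eq_assemble (x y t : ℝ) : (!₂[x, y, t] : R3) = assemble (x + y * I, t) := by
  rw [assemble_apply]
  simp

theorem stereoDiff_add (ω f g : ℂ) : stereoDiff ω (f + g) = stereoDiff ω f + stereoDiff ω g := by
  rw [stereoDiff, stereoDiff, stereoDiff, ← map_add, Prod.mk_add_mk, map_add]
  congr 2 <;> ring

theorem stereoDiff_smul (ω : ℂ) (c : ℝ) (f : ℂ) :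
    stereoDiff ω (c • f) = c • stereoDiff ω f := by
  rw [stereoDiff, stereoDiff, smul_assemble, real_smul, map_mul, conj_ofReal]
  congr 2 <;> ring

/-- The stereographic coordinate at `ω` of a tangent vector. -/
def tangentCoord (ω : ℂ) (v : R3) : ℂ :=
  (1 + ω * conj ω) / 2 * ((v 0 + v 1 * I) + ω * v 2)

/-- For `a`, `t` the components of `stereoDiff ω f`, the terms in `f̄` cancel in `a + ω t`, which
equals `2 ρ f`. -/
theorem tangentCoord_stereoDiff (ω f : ℂ) : tangentCoord ω (stereoDiff ω f) = f := by
  set a := 2 * density ω ^ 2 * (f - ω ^ 2 * conj f) with ha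
  set t := 2 * density ω ^ 2 * (conj ω * f + ω * conj f) with ht
  have h1 : ((stereoDiff ω f 0 : ℝ) : ℂ) + (stereoDiff ω f 1 : ℝ) * I = a := by
    rw [stereoDiff, ← ha, ← ht, assemble_apply]
    simp
  have h2 : ((stereoDiff ω f 2 : ℝ) : ℂ) = t := by
    rw [stereoDiff, ← ha, ← ht, assemble_apply]
    have hc : conj t = t := by
      simp only [ht, map_mul, map_add, map_pow, conj_conj, conj_density, map_ofNat]
      ring
    simpa using conj_eq_iff_re.1 hc
  rw [tangentCoord, h1, h2, ha, ht]
  simp only [density]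
  have := one_add_mul_conj_ne_zero ω
  field_simp
  ring

/-- Tangency is the relation `ω̄ a + ω ā + (|ω|² - 1) t = 0`, exactly what is needed to recover both
components. -/
theorem stereoDiff_tangentCoord {ω : ℂ} {v : R3} (h : ⟪stereo ω, v⟫_ℝ = 0) :
    stereoDiff ω (tangentCoord ω v) = v := by
  have hv : v = assemble (v 0 + v 1 * I, v 2) := by
    rw [← coord_eq_assemble]
    ext i
    fin_cases i <;> rfl
  set a : ℂ := v 0 + v 1 * I with ha
  have h1 : conj ω * a + ω * conj a + (ω * conj ω - 1) * v 2 = 0 := by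
    rw [stereo_eq_assemble, hv, inner_assemble] at h
    have hre : ∀ x : ℂ, ((x.re : ℝ) : ℂ) = (x + conj x) / 2 := fun x => re_eq_add_conj x
    have h' := congrArg (fun x : ℝ => (x : ℂ)) h
    simp only [ofReal_add, ofReal_mul, hre, map_mul, map_sub, conj_density, map_one, conj_conj,
      conj_ofReal, ofReal_zero, map_ofNat] at h'
    clear_value a
    linear_combination (1 + ω * conj ω) * h'
      + (2 * v 2 - (ω * conj a + conj ω * a)) * density_mul ω
  conv_rhs => rw [hv]
  rw [stereoDiff, tangentCoord, ← ha]
  simp only [map_mul, map_add, map_div₀, map_one, conj_conj, conj_ofReal, map_ofNat, density]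
  have := one_add_mul_conj_ne_zero ω
  have h3 : 1 + conj ω * ω ≠ 0 := by rwa [mul_comm (conj ω)]
  congr 2
  · field_simp
    linear_combination (-ω) * h1
  · field_simp
    linear_combination h1

/-- Conformality of `S`; it converts the bound on `v` into the growth bound on `f`. -/
theorem norm_stereoDiff (ω f : ℂ) : (1 + ‖ω‖ ^ 2) * ‖stereoDiff ω f‖ = 2 * ‖f‖ := by
  have h : ((1 + ‖ω‖ ^ 2) * ‖stereoDiff ω f‖) ^ 2 = (2 * ‖f‖) ^ 2 := by
    rw [mul_pow, ← real_inner_self_eq_norm_sq (stereoDiff ω f), stereoDiff, inner_assemble]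
    have hre : ∀ x : ℂ, ((x.re : ℝ) : ℂ) = (x + conj x) / 2 := fun x => re_eq_add_conj x
    have hn : ∀ x : ℂ, ((‖x‖ : ℝ) : ℂ) ^ 2 = x * conj x := fun x => by
      rw [mul_conj, normSq_eq_norm_sq, ofReal_pow]
    apply ofReal_injective
    push_cast
    simp only [mul_pow, hn]
    simp only [hre, map_mul, map_sub, map_add, map_pow, conj_conj, conj_density, map_ofNat]
    simp only [density]
    have := one_add_mul_conj_ne_zero ω
    field_simp
    ring
  exact (sq_eq_sq₀ (by positivity) (by positivity)).1 h

theorem contDiff_conj {n : WithTop ℕ∞} : ContDiff ℝ n fun z : ℂ => conj z :=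
  (conjCLE : ℂ →L[ℝ] ℂ).contDiff

theorem contDiff_pow_complex {n : WithTop ℕ∞} (k : ℕ) : ContDiff ℝ n fun z : ℂ => z ^ k :=
  contDiff_id.pow k

theorem contDiff_density_pow {n : WithTop ℕ∞} (m : ℕ) :
    ContDiff ℝ n fun z : ℂ => density (z ^ m) := by
  refine ContDiff.inv ?_ fun z => one_add_mul_conj_ne_zero (z ^ m)
  exact contDiff_const.add
    ((contDiff_pow_complex m).mul (contDiff_conj.comp (contDiff_pow_complex m)))

/-! ### Boundedness of all derivatives -/

section Bounded

/-- The function `z ^ a * z̄ ^ b / (1 + |z| ^ (2 m))`. -/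
def quotientMonomial (m a b : ℕ) (z : ℂ) : ℂ := z ^ a * conj z ^ b * density (z ^ m)

/-- The algebra generated by the bounded functions `z ^ a * z̄ ^ b / (1 + |z| ^ (2 m))`. -/
def quotientAlgebra (m : ℕ) : Subalgebra ℂ (ℂ → ℂ) :=
  Algebra.adjoin ℂ {q | ∃ a b, a + b ≤ 2 * m ∧ q = quotientMonomial m a b}

variable {m : ℕ}

theorem quotientMonomial_mem {a b : ℕ} (h : a + b ≤ 2 * m) :
    quotientMonomial m a b ∈ quotientAlgebra m :=
  Algebra.subset_adjoin ⟨a, b, h, rfl⟩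

theorem norm_quotientMonomial_le {a b : ℕ} (h : a + b ≤ 2 * m) (z : ℂ) :
    ‖quotientMonomial m a b z‖ ≤ 1 := by
  rw [quotientMonomial, density_eq_ofReal, norm_mul, norm_mul, norm_pow, norm_pow, RCLike.norm_conj,
    ← pow_add, norm_real, norm_pow, norm_inv, ← pow_mul, mul_comm m 2,
    Real.norm_of_nonneg (by positivity), ← div_eq_mul_inv, div_le_one (by positivity)]
  rcases le_total ‖z‖ 1 with h1 | h1
  · have := pow_le_one₀ (n := a + b) (norm_nonneg z) h1
    have : 0 ≤ ‖z‖ ^ (2 * m) := by positivity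
    linarith
  · have := pow_le_pow_right₀ h1 h
    linarith

theorem hasWirtingerDerivAt_quotientMonomial (a b : ℕ) (z : ℂ) :
    HasWirtingerDerivAt (quotientMonomial m a b)
      ((a : ℂ) * quotientMonomial m (a - 1) b z
        - m * (quotientMonomial m a b z * quotientMonomial m (m - 1) m z))
      ((b : ℂ) * quotientMonomial m a (b - 1) z
        - m * (quotientMonomial m a b z * quotientMonomial m m (m - 1) z)) z := by
  have h := ((HasWirtingerDerivAt.of_hasDerivAt (hasDerivAt_pow a z)).mul
    (hasWirtingerDerivAt_conj_pow b z)).mul (hasWirtingerDerivAt_density (hasDerivAt_pow m z))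
  simp only [map_pow] at h
  refine h.congr_deriv ?_ ?_ <;>
  · simp only [quotientMonomial, map_mul, map_pow, map_natCast]
    ring

theorem contDiff_of_mem {n : WithTop ℕ∞} {p : ℂ → ℂ} (hp : p ∈ quotientAlgebra m) :
    ContDiff ℝ n p := by
  induction hp using Algebra.adjoin_induction with
  | mem p hp =>
    obtain ⟨a, b, -, rfl⟩ := hp
    exact ((contDiff_pow_complex a).mul (contDiff_conj.pow b)).mul (contDiff_density_pow m)
  | algebraMap c => exact contDiff_const
  | add p q _ _ hp hq => exact hp.add hq
  | mul p q _ _ hp hq => exact hp.mul hq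

theorem exists_norm_le_of_mem {p : ℂ → ℂ} (hp : p ∈ quotientAlgebra m) :
    ∃ C : ℝ, ∀ z, ‖p z‖ ≤ C := by
  induction hp using Algebra.adjoin_induction with
  | mem p hp =>
    obtain ⟨a, b, h, rfl⟩ := hp
    exact ⟨1, norm_quotientMonomial_le h⟩
  | algebraMap c => exact ⟨‖c‖, fun z => le_of_eq rfl⟩
  | add p q _ _ hp hq =>
    obtain ⟨C, hC⟩ := hp
    obtain ⟨D, hD⟩ := hq
    exact ⟨C + D, fun z => (norm_add_le _ _).trans (add_le_add (hC z) (hD z))⟩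
  | mul p q _ _ hp hq =>
    obtain ⟨C, hC⟩ := hp
    obtain ⟨D, hD⟩ := hq
    exact ⟨C * D, fun z => (norm_mul_le _ _).trans
      (mul_le_mul (hC z) (hD z) (norm_nonneg _) ((norm_nonneg _).trans (hC z)))⟩

/-- Differentiating `ρ` produces another bounded quotient of the same kind, so the algebra is stable
under `∂` and `∂̄`. Induction then bounds derivatives of every order without computing them. -/
theorem exists_wirtinger_of_mem {p : ℂ → ℂ} (hp : p ∈ quotientAlgebra m) :
    ∃ p₁ ∈ quotientAlgebra m, ∃ p₂ ∈ quotientAlgebra m,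
      ∀ z, HasWirtingerDerivAt p (p₁ z) (p₂ z) z := by
  induction hp using Algebra.adjoin_induction with
  | mem p hp =>
    obtain ⟨a, b, h, rfl⟩ := hp
    have key : ∀ (k : ℕ) {a' b' c d : ℕ}, a' + b' ≤ 2 * m → c + d ≤ 2 * m →
        (k : ℂ) • quotientMonomial m a' b' - (m : ℂ) • (quotientMonomial m a b
          * quotientMonomial m c d) ∈ quotientAlgebra m := fun k _ _ _ _ h1 h2 =>
      sub_mem (Subalgebra.smul_mem _ (quotientMonomial_mem h1) _)
        (Subalgebra.smul_mem _ (mul_mem (quotientMonomial_mem h) (quotientMonomial_mem h2)) _)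
    -- If `a = 0` or `b = 0`, the truncated exponent is harmless because its coefficient is zero.
    exact ⟨_, key a (a' := a - 1) (b' := b) (c := m - 1) (d := m) (by omega) (by omega), _,
      key b (a' := a) (b' := b - 1) (c := m) (d := m - 1) (by omega) (by omega),
      fun z => hasWirtingerDerivAt_quotientMonomial a b z⟩
  | algebraMap c =>
    exact ⟨0, zero_mem _, 0, zero_mem _, fun z => HasWirtingerDerivAt.const c⟩
  | add p q _ _ hp hq =>
    obtain ⟨p₁, h1, p₂, h2, hp⟩ := hp
    obtain ⟨q₁, h3, q₂, h4, hq⟩ := hq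
    exact ⟨_, add_mem h1 h3, _, add_mem h2 h4, fun z => (hp z).add (hq z)⟩
  | mul p q hpm hqm hp hq =>
    obtain ⟨p₁, h1, p₂, h2, hp⟩ := hp
    obtain ⟨q₁, h3, q₂, h4, hq⟩ := hq
    exact ⟨_, add_mem (mul_mem h1 hqm) (mul_mem hpm h3), _,
      add_mem (mul_mem h2 hqm) (mul_mem hpm h4), fun z => (hp z).mul (hq z)⟩

theorem exists_norm_iteratedFDeriv_comp_add_le {E : Type*} [NormedAddCommGroup E] [NormedSpace ℝ E]
    (L L' : ℂ →L[ℝ] E) {p q : ℂ → ℂ} {n : ℕ} (hp : ContDiff ℝ n p) (hq : ContDiff ℝ n q)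
    (hpb : ∃ C : ℝ, ∀ z, ‖iteratedFDeriv ℝ n p z‖ ≤ C)
    (hqb : ∃ C : ℝ, ∀ z, ‖iteratedFDeriv ℝ n q z‖ ≤ C) :
    ∃ C : ℝ, ∀ z, ‖iteratedFDeriv ℝ n (L ∘ p + L' ∘ q) z‖ ≤ C := by
  obtain ⟨C, hC⟩ := hpb
  obtain ⟨D, hD⟩ := hqb
  refine ⟨‖L‖ * C + ‖L'‖ * D, fun z => ?_⟩
  rw [iteratedFDeriv_add_apply (L.contDiff.comp hp).contDiffAt (L'.contDiff.comp hq).contDiffAt]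
  refine (norm_add_le _ _).trans (add_le_add ?_ ?_)
  · exact (L.norm_iteratedFDeriv_comp_left hp.contDiffAt le_rfl).trans
      (mul_le_mul_of_nonneg_left (hC z) (norm_nonneg _))
  · exact (L'.norm_iteratedFDeriv_comp_left hq.contDiffAt le_rfl).trans
      (mul_le_mul_of_nonneg_left (hD z) (norm_nonneg _))

theorem exists_norm_iteratedFDeriv_le_of_mem (n : ℕ) : ∀ {p : ℂ → ℂ}, p ∈ quotientAlgebra m →
    ∃ C : ℝ, ∀ z, ‖iteratedFDeriv ℝ n p z‖ ≤ C := by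
  induction n with
  | zero => intro p hp; simpa using exists_norm_le_of_mem hp
  | succ n ih =>
    intro p hp
    obtain ⟨p₁, h1, p₂, h2, hd⟩ := exists_wirtinger_of_mem hp
    have hfd : fderiv ℝ p = (ContinuousLinearMap.id ℝ ℂ).smulRight (1 : ℂ →L[ℝ] ℂ) ∘ p₁
        + (ContinuousLinearMap.id ℝ ℂ).smulRight (conjCLE : ℂ →L[ℝ] ℂ) ∘ p₂ := by
      funext z
      exact HasFDerivAt.fderiv (hd z)
    simp only [← norm_iteratedFDeriv_fderiv, hfd]
    exact exists_norm_iteratedFDeriv_comp_add_le _ _ (contDiff_of_mem h1) (contDiff_of_mem h2)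
      (ih h1) (ih h2)

theorem isC2Bounded_assemble {a t : ℂ → ℂ} (ha : a ∈ quotientAlgebra m)
    (ht : t ∈ quotientAlgebra m) : IsC2Bounded fun z => assemble (a z, t z) := by
  have heq : (fun z => assemble (a z, t z))
      = (assemble.comp (ContinuousLinearMap.inl ℝ ℂ ℂ)) ∘ a
        + (assemble.comp (ContinuousLinearMap.inr ℝ ℂ ℂ)) ∘ t := by
    funext z
    simp [← map_add]
  have hb : ∀ n : ℕ, ∃ C : ℝ, ∀ z, ‖iteratedFDeriv ℝ n (fun z => assemble (a z, t z)) z‖ ≤ C := by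
    intro n
    rw [heq]
    exact exists_norm_iteratedFDeriv_comp_add_le _ _ (contDiff_of_mem ha) (contDiff_of_mem ht)
      (exists_norm_iteratedFDeriv_le_of_mem n ha) (exists_norm_iteratedFDeriv_le_of_mem n ht)
  refine ⟨assemble.contDiff.comp ((contDiff_of_mem ha).prodMk (contDiff_of_mem ht)), ?_⟩
  obtain ⟨C₀, h0⟩ := hb 0
  obtain ⟨C₁, h1⟩ := hb 1
  obtain ⟨C₂, h2⟩ := hb 2
  simp only [norm_iteratedFDeriv_zero] at h0
  simp only [norm_iteratedFDeriv_one] at h1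
  exact ⟨C₀ + C₁ + C₂, fun z => add_le_add (add_le_add (h0 z) (h1 z)) (h2 z)⟩

end Bounded

end

end HarmonicMapKernel

/-! ### The explicit fields as polynomials -/

namespace HarmonicMapKernel

open Complex ComplexConjugate

noncomputable section

variable {m : ℕ}

/-- The field along `U m` with stereographic coordinate `c * z ^ j`. -/
def monomialField (m : ℕ) (c : ℂ) (j : ℕ) (z : ℂ) : R3 := stereoDiff (z ^ m) (c * z ^ j)

theorem smul_monomialField (x : ℝ) (c : ℂ) (j : ℕ) :
    x • monomialField m c j = monomialField m (x * c) j := by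
  funext z
  rw [Pi.smul_apply, monomialField, monomialField, ← stereoDiff_smul, real_smul, mul_assoc]

theorem add_monomialField (c c' : ℂ) (j : ℕ) :
    monomialField m c j + monomialField m c' j = monomialField m (c + c') j := by
  funext z
  rw [Pi.add_apply, monomialField, monomialField, monomialField, ← stereoDiff_add, add_mul]

section PolarForm

variable (z : ℂ)

/-- Also valid at `z = 0`, where `arg` is `0` by convention; the polar formulas for the fields thus
need no separate treatment of the origin. -/
theorem polar_form (j : ℕ) : z ^ j = ‖z‖ ^ j * exp (z.arg * I) ^ j := by
  rw [← mul_pow, norm_mul_exp_arg_mul_I]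

theorem exp_arg_pow (j : ℕ) : exp (z.arg * I) ^ j
    = (Real.cos (j * z.arg) : ℝ) + (Real.sin (j * z.arg) : ℝ) * I := by
  rw [← exp_nat_mul, ← mul_assoc, exp_mul_I]
  push_cast
  rfl

theorem exp_arg_pow_mul_conj (j : ℕ) :
    exp (z.arg * I) ^ j * conj (exp (z.arg * I) ^ j) = 1 := by
  rw [mul_conj, normSq_eq_norm_sq, norm_pow, norm_exp_ofReal_mul_I]
  simp

theorem density_pow (m : ℕ) : density (z ^ m) = ((1 + ‖z‖ ^ (2 * m))⁻¹ : ℝ) := by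
  rw [density_eq_ofReal, norm_pow, ← pow_mul, mul_comm m 2]

theorem cos_Q (r : ℝ) : Real.cos (Q m r) = (r ^ (2 * m) - 1) / (1 + r ^ (2 * m)) := by
  have h := Real.cos_sq_arctan (r ^ m)
  rw [Q, Real.cos_pi_sub, Real.cos_two_mul, h, ← pow_mul, mul_comm m 2]
  have : 1 + r ^ (2 * m) ≠ 0 := by
    rw [mul_comm, pow_mul]
    positivity
  field_simp
  ring

theorem sin_Q (r : ℝ) : Real.sin (Q m r) = 2 * r ^ m / (1 + r ^ (2 * m)) := by
  have h := Real.cos_sq_arctan (r ^ m)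
  have hc : Real.cos (Real.arctan (r ^ m)) ≠ 0 := (Real.cos_arctan_pos _).ne'
  have ht := Real.tan_arctan (r ^ m)
  rw [Real.tan_eq_sin_div_cos, div_eq_iff hc] at ht
  rw [Q, Real.sin_pi_sub, Real.sin_two_mul, ht]
  calc 2 * (r ^ m * Real.cos (Real.arctan (r ^ m))) * Real.cos (Real.arctan (r ^ m))
      = 2 * r ^ m * Real.cos (Real.arctan (r ^ m)) ^ 2 := by ring
    _ = _ := by rw [h, ← pow_mul, mul_comm m 2, mul_one_div]

/-- `E1` is the unit angular direction `i e^{imθ}` of the `w`-plane; `(1 + r^{2m}) / 2` undoes the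
conformal factor. Likewise `E2` is the inward radial direction, since `Q` decreases with `r`. -/
theorem E1_eq_stereoDiff : E1 m z
    = stereoDiff (z ^ m) (((1 + ‖z‖ ^ (2 * m) : ℝ) : ℂ) / 2 * (I * exp (z.arg * I) ^ m)) := by
  have hu := exp_arg_pow_mul_conj z m
  have hpos : (((1 + ‖z‖ ^ (2 * m)) : ℝ) : ℂ) ≠ 0 :=
    ofReal_ne_zero.2 (by positivity : 0 < 1 + ‖z‖ ^ (2 * m)).ne'
  rw [E1, coord_eq_assemble, stereoDiff, density_pow]
  have h1 : (((-Real.sin (m * z.arg) : ℝ) : ℂ) + (Real.cos (m * z.arg) : ℝ) * I)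
      = I * exp (z.arg * I) ^ m := by
    rw [exp_arg_pow]
    push_cast
    linear_combination (-sin (m * z.arg)) * I_sq
  rw [h1, polar_form z m]
  generalize exp (z.arg * I) ^ m = u at *
  simp only [map_mul, map_div₀, map_pow, conj_ofReal, conj_I, map_ofNat, ofReal_inv]
  have h2 : ((1 + ‖z‖ ^ (2 * m) : ℝ) : ℂ) = 1 + (‖z‖ ^ m : ℂ) ^ 2 := by push_cast; ring
  rw [h2] at hpos ⊢
  congr 2
  · field_simp
    linear_combination (-(‖z‖ ^ m : ℂ) ^ 2 * u) * hu
  · field_simp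
    push_cast
    ring

theorem E2_eq_stereoDiff : E2 m z
    = stereoDiff (z ^ m) (((1 + ‖z‖ ^ (2 * m) : ℝ) : ℂ) / 2 * (-exp (z.arg * I) ^ m)) := by
  have hu := exp_arg_pow_mul_conj z m
  have hpos : (((1 + ‖z‖ ^ (2 * m)) : ℝ) : ℂ) ≠ 0 :=
    ofReal_ne_zero.2 (by positivity : 0 < 1 + ‖z‖ ^ (2 * m)).ne'
  rw [E2, coord_eq_assemble, stereoDiff, density_pow, cos_Q, sin_Q]
  have h1 : ((Real.cos (m * z.arg) * ((‖z‖ ^ (2 * m) - 1) / (1 + ‖z‖ ^ (2 * m))) : ℝ) : ℂ)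
      + (Real.sin (m * z.arg) * ((‖z‖ ^ (2 * m) - 1) / (1 + ‖z‖ ^ (2 * m))) : ℝ) * I
      = exp (z.arg * I) ^ m * ((‖z‖ ^ (2 * m) - 1 : ℝ) : ℂ) / (1 + ‖z‖ ^ (2 * m) : ℝ) := by
    rw [exp_arg_pow]
    push_cast
    ring
  rw [h1, polar_form z m]
  generalize exp (z.arg * I) ^ m = u at *
  simp only [map_mul, map_div₀, map_pow, map_neg, conj_ofReal, map_ofNat, ofReal_inv, ofReal_neg,
    ofReal_div]
  have h2 : ((1 + ‖z‖ ^ (2 * m) : ℝ) : ℂ) = 1 + (‖z‖ ^ m : ℂ) ^ 2 := by push_cast; ring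
  have h3 : ((‖z‖ ^ (2 * m) - 1 : ℝ) : ℂ) = (‖z‖ ^ m : ℂ) ^ 2 - 1 := by push_cast; ring
  rw [h2] at hpos ⊢
  rw [h3]
  congr 2
  · field_simp
    linear_combination (-(‖z‖ ^ m : ℂ) ^ 2 * u) * hu
  · field_simp
    push_cast
    linear_combination (2 * (‖z‖ ^ m : ℂ)) * hu

end PolarForm

/-- Linear combinations of `E1` and `E2` in the stereographic coordinate. -/
theorem smul_add_E1_E2 (m : ℕ) (z : ℂ) (r x y : ℝ) :
    (r / (1 + ‖z‖ ^ (2 * m))) • (x • E1 m z + y • E2 m z)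
      = stereoDiff (z ^ m) ((r : ℂ) / 2 * (x * I - y) * exp (z.arg * I) ^ m) := by
  have hpos : (((1 + ‖z‖ ^ (2 * m)) : ℝ) : ℂ) ≠ 0 :=
    ofReal_ne_zero.2 (by positivity : 0 < 1 + ‖z‖ ^ (2 * m)).ne'
  rw [E1_eq_stereoDiff, E2_eq_stereoDiff, ← stereoDiff_smul, ← stereoDiff_smul, ← stereoDiff_add,
    ← stereoDiff_smul, real_smul, real_smul, real_smul, ofReal_div]
  congr 1
  field_simp
  ring

theorem exp_arg_pow_sub (z : ℂ) {m k : ℕ} (hk : k ≤ m) :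
    exp (z.arg * I) ^ (m - k) = ((Real.cos (k * z.arg) : ℝ) - (Real.sin (k * z.arg) : ℝ) * I)
      * exp (z.arg * I) ^ m := by
  have h1 := exp_arg_pow_mul_conj z k
  have h2 : conj (exp (z.arg * I) ^ k)
      = (Real.cos (k * z.arg) : ℝ) - (Real.sin (k * z.arg) : ℝ) * I := by
    rw [exp_arg_pow, map_add, map_mul, conj_ofReal, conj_ofReal, conj_I]
    ring
  rw [← h2]
  conv_rhs => rw [← Nat.sub_add_cancel hk, pow_add]
  linear_combination (-exp (z.arg * I) ^ (m - k)) * h1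

theorem Ek1_eq {k : ℕ} (hk : k ≤ m) : Ek1 m k = monomialField m (-I / 2) (m - k) := by
  funext z
  rw [Ek1, smul_add_E1_E2, monomialField, polar_form z (m - k), exp_arg_pow_sub z hk]
  congr 1
  push_cast
  linear_combination (‖z‖ ^ (m - k) / 2 * sin (k * z.arg) * exp (z.arg * I) ^ m) * -I_sq

theorem Ek2_eq {k : ℕ} (hk : k ≤ m) : Ek2 m k = monomialField m (-1 / 2) (m - k) := by
  funext z
  rw [Ek2, smul_add_E1_E2, monomialField, polar_form z (m - k), exp_arg_pow_sub z hk]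
  congr 1
  push_cast
  ring

theorem Et1_eq (ν : ℕ) : Et1 m ν = monomialField m (-I / 2) (m + ν) := by
  funext z
  rw [Et1, sub_eq_add_neg, ← neg_smul, smul_add_E1_E2, monomialField, polar_form z (m + ν),
    pow_add (exp _), exp_arg_pow z ν]
  congr 1
  push_cast
  linear_combination (‖z‖ ^ (m + ν) / 2 * sin (ν * z.arg) * exp (z.arg * I) ^ m) * I_sq

theorem Et2_eq (ν : ℕ) : Et2 m ν = monomialField m (-1 / 2) (m + ν) := by
  funext z
  rw [Et2, smul_add_E1_E2, monomialField, polar_form z (m + ν), pow_add (exp _), exp_arg_pow z ν]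
  congr 1
  push_cast
  ring

theorem pow_re_add_im (z : ℂ) (m : ℕ) :
    z ^ m = ((‖z‖ ^ m * Real.cos (m * z.arg) : ℝ) : ℂ)
      + ((‖z‖ ^ m * Real.sin (m * z.arg) : ℝ) : ℂ) * I := by
  rw [polar_form z m, exp_arg_pow]
  push_cast
  ring

theorem normSq_pow (z : ℂ) (m : ℕ) :
    ((‖z‖ ^ (2 * m) : ℝ) : ℂ) = z ^ m * conj (z ^ m) := by
  rw [mul_conj, normSq_eq_norm_sq, norm_pow, ← pow_mul, mul_comm m 2]

/-- The field is an infinitesimal rotation of the sphere about the first axis; such rotations are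
quadratic in `w`, hence the pair of degrees `2 * m` and `0`. -/
theorem Em1_eq : Em1 m = monomialField m (I / 2) (2 * m) + monomialField m (-I / 2) 0 := by
  funext z
  have h1 : ((‖z‖ ^ m * Real.sin (m * z.arg) : ℝ) : ℂ)
      = (z ^ m - conj (z ^ m)) / 2 * -I := by
    rw [pow_re_add_im z m, map_add, map_mul, conj_ofReal, conj_ofReal, conj_I]
    linear_combination ((‖z‖ ^ m * Real.sin (m * z.arg) : ℝ) : ℂ) * I_sq
  have hpos := one_add_mul_conj_ne_zero (z ^ m)
  rw [Pi.add_apply, monomialField, monomialField, ← stereoDiff_add, Em1, coord_eq_assemble,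
    stereoDiff]
  rw [mul_assoc, ofReal_neg, ofReal_div, ofReal_div, ofReal_mul, h1, ofReal_sub, ofReal_add,
    normSq_pow]
  simp only [density, map_add, map_mul, map_pow, map_div₀, map_neg, conj_I, map_ofNat, ofReal_ofNat,
    ofReal_one, ofReal_zero, pow_zero, map_one] at hpos ⊢
  have hpos' : z ^ m * conj z ^ m + 1 ≠ 0 := by rwa [add_comm]
  congr 2
  · field_simp
    ring
  · field_simp
    ring

theorem Em2_eq : Em2 m = monomialField m (-1 / 2) (2 * m) + monomialField m (-1 / 2) 0 := by
  funext z
  have h1 : ((‖z‖ ^ m * Real.cos (m * z.arg) : ℝ) : ℂ) = (z ^ m + conj (z ^ m)) / 2 := by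
    rw [pow_re_add_im z m, map_add, map_mul, conj_ofReal, conj_ofReal, conj_I]
    ring
  have hpos := one_add_mul_conj_ne_zero (z ^ m)
  rw [Pi.add_apply, monomialField, monomialField, ← stereoDiff_add, Em2, coord_eq_assemble,
    stereoDiff]
  rw [mul_assoc, ofReal_neg, ofReal_div, ofReal_div, ofReal_mul, h1, ofReal_sub, ofReal_add,
    normSq_pow]
  simp only [density, map_add, map_mul, map_pow, map_div₀, map_neg, map_ofNat, ofReal_ofNat,
    ofReal_one, ofReal_zero, pow_zero, map_one] at hpos ⊢
  have hpos' : z ^ m * conj z ^ m + 1 ≠ 0 := by rwa [add_comm]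
  congr 2
  · field_simp
    ring
  · field_simp
    ring

/-- The fields along `U m` whose stereographic coordinate is a polynomial of degree at most
`2 * m`. -/
def polynomialField (m : ℕ) : (Fin (2 * m + 1) → ℂ) →ₗ[ℝ] (ℂ → R3) where
  toFun c z := stereoDiff (z ^ m) (∑ i, c i * z ^ (i : ℕ))
  map_add' c d := by
    funext z
    simp only [Pi.add_apply, ← stereoDiff_add, add_mul, Finset.sum_add_distrib]
  map_smul' x c := by
    funext z
    simp only [Pi.smul_apply, RingHom.id_apply, ← stereoDiff_smul, smul_mul_assoc, Finset.smul_sum]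

theorem polynomialField_eq_sum (c : Fin (2 * m + 1) → ℂ) :
    polynomialField m c = ∑ i : Fin (2 * m + 1), monomialField m (c i) i := by
  funext z
  let L : ℂ →+ R3 := ⟨⟨stereoDiff (z ^ m), by simpa using stereoDiff_smul (z ^ m) 0 0⟩,
    stereoDiff_add (z ^ m)⟩
  rw [Finset.sum_apply]
  exact map_sum L _ _

theorem monomialField_mem_range (c : ℂ) {j : ℕ} (hj : j ≤ 2 * m) :
    monomialField m c j ∈ LinearMap.range (polynomialField m) := by
  refine ⟨Pi.single ⟨j, by omega⟩ c, ?_⟩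
  funext z
  change stereoDiff _ _ = stereoDiff _ _
  congr 1
  rw [Finset.sum_eq_single ⟨j, by omega⟩]
  · simp
  · intro i _ hi
    simp [hi]
  · simp

/-- A vanishing field gives a polynomial vanishing at the `2m + 1` nodes `0, …, 2m`; the Vandermonde
matrix is invertible. -/
theorem polynomialField_injective : Function.Injective (polynomialField m) := by
  rw [injective_iff_map_eq_zero]
  intro c hc
  refine Matrix.eq_zero_of_forall_index_sum_pow_mul_eq_zero
    (f := fun j : Fin (2 * m + 1) => ((j : ℕ) : ℂ)) (fun i j h => ?_) fun j => ?_
  · exact Fin.ext (Nat.cast_injective h)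
  · have h1 := congrFun hc ((j : ℕ) : ℂ)
    have h2 := congrArg (tangentCoord (((j : ℕ) : ℂ) ^ m)) h1
    change tangentCoord _ (stereoDiff _ _) = _ at h2
    rw [tangentCoord_stereoDiff] at h2
    simpa [tangentCoord, mul_comm] using h2

theorem span_kernelFields (hm : 1 ≤ m) :
    Submodule.span ℝ (kernelFields m) = LinearMap.range (polynomialField m) := by
  apply le_antisymm
  · rw [Submodule.span_le]
    rintro v ((⟨k, hk, rfl | rfl⟩ | ⟨ν, h1, h2, rfl | rfl⟩) | rfl | rfl)
    · rw [Ek1_eq hk]; exact monomialField_mem_range _ (by omega)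
    · rw [Ek2_eq hk]; exact monomialField_mem_range _ (by omega)
    · rw [Et1_eq]; exact monomialField_mem_range _ (by omega)
    · rw [Et2_eq]; exact monomialField_mem_range _ (by omega)
    · rw [Em1_eq]
      exact add_mem (monomialField_mem_range _ (by omega)) (monomialField_mem_range _ (by omega))
    · rw [Em2_eq]
      exact add_mem (monomialField_mem_range _ (by omega)) (monomialField_mem_range _ (by omega))
  · rintro _ ⟨c, rfl⟩
    rw [polynomialField_eq_sum]
    refine sum_mem fun i _ => ?_
    have key : ∀ j, j ≤ 2 * m →
        monomialField m (-I / 2) j ∈ Submodule.span ℝ (kernelFields m) ∧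
        monomialField m (-1 / 2) j ∈ Submodule.span ℝ (kernelFields m) := by
      have low : ∀ j, j ≤ m →
          monomialField m (-I / 2) j ∈ Submodule.span ℝ (kernelFields m) ∧
          monomialField m (-1 / 2) j ∈ Submodule.span ℝ (kernelFields m) := by
        intro j hj
        have e : m - (m - j) = j := by omega
        constructor
        · have h := Ek1_eq (m := m) (k := m - j) (by omega)
          rw [e] at h
          exact Submodule.subset_span (.inl (.inl ⟨m - j, by omega, .inl h.symm⟩))
        · have h := Ek2_eq (m := m) (k := m - j) (by omega)
          rw [e] at h
          exact Submodule.subset_span (.inl (.inl ⟨m - j, by omega, .inr h.symm⟩))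
      intro j hj
      rcases le_or_gt j m with h1 | h1
      · exact low j h1
      rcases hj.lt_or_eq with h2 | rfl
      · have e : m + (j - m) = j := by omega
        constructor
        · have h := Et1_eq (m := m) (j - m)
          rw [e] at h
          exact Submodule.subset_span (.inl (.inr ⟨j - m, by omega, by omega, .inl h.symm⟩))
        · have h := Et2_eq (m := m) (j - m)
          rw [e] at h
          exact Submodule.subset_span (.inl (.inr ⟨j - m, by omega, by omega, .inr h.symm⟩))
      -- In top degree the rotation fields carry an extra constant term, removed with the degree `0`
      -- fields already in the span.
      · have m1 : Em1 m ∈ Submodule.span ℝ (kernelFields m) :=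
          Submodule.subset_span (.inr (.inl rfl))
        have m2 : Em2 m ∈ Submodule.span ℝ (kernelFields m) :=
          Submodule.subset_span (.inr (.inr rfl))
        obtain ⟨l1, l2⟩ := low 0 (by omega)
        rw [Em1_eq] at m1
        rw [Em2_eq] at m2
        constructor
        · have h := Submodule.smul_mem _ (-1 : ℝ) (sub_mem m1 l1)
          rw [add_sub_cancel_right, smul_monomialField] at h
          convert h using 2
          push_cast
          ring
        · have h := sub_mem m2 l2
          rwa [add_sub_cancel_right] at h
    obtain ⟨k1, k2⟩ := key i (by omega)
    -- The factors `-2` normalize the real basis `-i/2`, `-1/2` of `ℂ`.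
    have h := add_mem (Submodule.smul_mem _ (-2 * (c i).im) k1)
      (Submodule.smul_mem _ (-2 * (c i).re) k2)
    rw [smul_monomialField, smul_monomialField, add_monomialField] at h
    convert h using 2
    conv_lhs => rw [← re_add_im (c i)]
    push_cast
    ring

/-! ### The kernel consists of the polynomial fields -/

theorem linOp_U (m : ℕ) {f : ℂ → ℂ} (hf : ContDiff ℝ 2 f) (z : ℂ) :
    linOp (U m) (fun z => stereoDiff (z ^ m) (f z)) z
      = stereoDiff (z ^ m) (4 * wirtinger (wirtingerBar f) z
        - 8 * conj (z ^ m) * (m * z ^ (m - 1)) * density (z ^ m) * wirtingerBar f z) :=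
  linOp_stereoDiff (w := fun z => z ^ m) (w₁ := fun z => m * z ^ (m - 1)) (hasDerivAt_pow m)
    (fun z => (hasDerivAt_pow (m - 1) z).const_mul _) (contDiff_density_pow m)
    (contDiff_pow_complex m) hf z

theorem monomialField_mem_kerL (c : ℂ) {j : ℕ} (hj : j ≤ 2 * m) :
    monomialField m c j ∈ kerL (U m) := by
  refine ⟨?_, fun z => inner_stereo_stereoDiff _ _, fun z => ?_⟩
  · have mem : ∀ {a b : ℕ}, a + b ≤ 2 * m → quotientMonomial m a b ∈ quotientAlgebra m :=
      quotientMonomial_mem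
    -- Each component carries `ρ²`; sharing it out gives each factor one `ρ` and total degree at
    -- most `2 * m`, which is where `j ≤ 2 * m` is used.
    have ha : (2 * c) • (quotientMonomial m 0 0 * quotientMonomial m j 0)
        - (2 * conj c) • (quotientMonomial m (2 * m) 0 * quotientMonomial m 0 j)
        ∈ quotientAlgebra m :=
      sub_mem (Subalgebra.smul_mem _ (mul_mem (mem (by omega)) (mem (by omega))) _)
        (Subalgebra.smul_mem _ (mul_mem (mem (by omega)) (mem (by omega))) _)
    have ht : (2 * c) • (quotientMonomial m 0 m * quotientMonomial m j 0)
        + (2 * conj c) • (quotientMonomial m m 0 * quotientMonomial m 0 j)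
        ∈ quotientAlgebra m :=
      add_mem (Subalgebra.smul_mem _ (mul_mem (mem (by omega)) (mem (by omega))) _)
        (Subalgebra.smul_mem _ (mul_mem (mem (by omega)) (mem (by omega))) _)
    convert isC2Bounded_assemble ha ht using 1
    funext z
    rw [monomialField, stereoDiff]
    congr 2
    · simp [quotientMonomial]
      ring
    · simp [quotientMonomial]
      ring
  · have hd : ∀ z, HasWirtingerDerivAt (fun z => c * z ^ j) (c * (j * z ^ (j - 1))) 0 z := fun z =>
      .of_hasDerivAt ((hasDerivAt_pow j z).const_mul c)
    have hbar : (wirtingerBar fun z => c * z ^ j) = fun _ => 0 :=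
      funext fun z => (hd z).eq_wirtingerBar
    have h := linOp_U m (f := fun z => c * z ^ j) (contDiff_const.mul (contDiff_pow_complex j)) z
    rw [hbar, (HasWirtingerDerivAt.const 0).eq_wirtinger] at h
    refine h.trans ?_
    simpa using stereoDiff_smul (z ^ m) 0 0

/-- Bounded solutions of the linearized equation have polynomial stereographic coordinate. -/
theorem mem_range_polynomialField (hm : 1 ≤ m) {v : ℂ → R3} (hv : ContDiff ℝ 2 v)
    (ht : IsTangentAlong (U m) v) (hb : ∃ C : ℝ, ∀ z, ‖v z‖ ≤ C)
    (hL : ∀ z, linOp (U m) v z = 0) : v ∈ LinearMap.range (polynomialField m) := by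
  obtain ⟨C, hC⟩ := hb
  set f : ℂ → ℂ := fun z => tangentCoord (z ^ m) (v z) with hf
  have hvf : v = fun z => stereoDiff (z ^ m) (f z) :=
    funext fun z => (stereoDiff_tangentCoord (ht z)).symm
  have hcoord : ∀ i, ContDiff ℝ 2 fun z => ((v z i : ℝ) : ℂ) := fun i =>
    ofRealCLM.contDiff.comp ((contDiff_euclidean.1 hv) i)
  have hp := contDiff_pow_complex (n := 2) m
  have hfc : ContDiff ℝ 2 f := by
    refine ContDiff.mul ?_ (((hcoord 0).add ((hcoord 1).mul contDiff_const)).add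
      (hp.mul (hcoord 2)))
    exact (contDiff_const.add (hp.mul (contDiff_conj.comp hp))).div_const 2
  -- `tangentCoord` is a left inverse of `stereoDiff`, so it turns `L v = 0` into the scalar
  -- equation; `C / 2` comes from the conformal factor.
  obtain ⟨c, hc⟩ := exists_eq_sum_of_linearized hm hfc (C := C / 2) (fun z => by
    have h := hL z
    rw [hvf, linOp_U m hfc z] at h
    have h2 := congrArg (tangentCoord (z ^ m)) h
    rw [tangentCoord_stereoDiff] at h2
    simp only [tangentCoord, PiLp.zero_apply, ofReal_zero] at h2
    linear_combination h2 / 4) (fun z => by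
    have h := norm_stereoDiff (z ^ m) (f z)
    have h1 := hC z
    rw [congrFun hvf z] at h1
    rw [norm_pow, ← pow_mul, mul_comm m 2] at h
    nlinarith [pow_nonneg (norm_nonneg z) (2 * m)])
  refine ⟨c, ?_⟩
  rw [hvf]
  funext z
  rw [hc z]
  rfl

theorem range_polynomialField_le_kerL :
    LinearMap.range (polynomialField m) ≤ kerL (U m) := by
  rintro _ ⟨c, rfl⟩
  rw [polynomialField_eq_sum]
  exact sum_mem fun i _ => monomialField_mem_kerL _ (by omega)

end

end HarmonicMapKernel

theorem corollary1 (m : ℕ) (hm : 1 ≤ m) :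
    (∀ v : ℂ → R3, ContDiff ℝ 2 v → IsTangentAlong (U m) v → (∃ C : ℝ, ∀ z, ‖v z‖ ≤ C) →
      (∀ z, linOp (U m) v z = 0) → v ∈ Submodule.span ℝ (kernelFields m)) ∧
    kerL (U m) = Submodule.span ℝ (kernelFields m) ∧
    Module.finrank ℝ (kerL (U m)) = 4 * m + 2 := by
  have hker : kerL (U m) = LinearMap.range (polynomialField m) := by
    refine le_antisymm ?_ range_polynomialField_le_kerL
    rintro v ⟨⟨hv, C, hC⟩, ht, hL⟩
    refine mem_range_polynomialField hm hv ht ⟨C, fun z => ?_⟩ hL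
    linarith [hC z, norm_nonneg (fderiv ℝ v z), norm_nonneg (iteratedFDeriv ℝ 2 v z)]
  rw [span_kernelFields hm]
  refine ⟨fun v hv ht hb hL => mem_range_polynomialField hm hv ht hb hL, hker, ?_⟩
  rw [hker, LinearMap.finrank_range_of_inj polynomialField_injective, Module.finrank_pi_fintype]
  simp only [Complex.finrank_real_complex, Finset.sum_const, Finset.card_univ, Fintype.card_fin,
    smul_eq_mul]
  ring
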